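/- Let $n \ge 1$. Let $\mathbf{H}^{n+1}$ be $(n+1)$-dimensional real hyperbolic space in the hyperboloid model, i.e. the sheet $x_{n+1}>0$ of $\{x\in\mathbb{R}^{n+2} : \langle x,x\rangle=-1\}$, where $\langle x,y\rangle = x_0y_0+\dots+x_ny_n-x_{n+1}y_{n+1}$, with the metric $\cosh d(x,y)=-\langle x,y\rangle$. Let $M(n)$ be the Möbius group, that is, the isometry group of $\mathbf{H}^{n+1}$ (equivalently, by Poincaré extension, the group of Möbius transformations of the boundary sphere $\mathbb{S}^n$), with the topology of pointwise convergence, and let $M_o(n)$ be its identity component, which is the group of orientation-preserving elements of $M(n)$. Let $SO_o(n+1,1)$ be the identity component of the group $SO(n+1,1)$ of linear maps of determinant $1$ of $\mathbb{R}^{n+2}$ that preserve $\langle\cdot,\cdot\rangle$. An element $g$ of a group $G$ is called real if there is $h\in G$ with $hgh^{-1}=g^{-1}$. Then restriction of linear maps to $\mathbf{H}^{n+1}$ is a group isomorphism $SO_o(n+1,1)\cong M_o(n)$, and every element of $M_o(n)$ is real in $M_o(n)$ if and only if $n\equiv 2$ or $n\equiv 3 \pmod 4$. -/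

import Mathlib

namespace MoebiusReal

/-- The Lorentz form of signature `(d, 1)` on `ℝ^(d+1)`:
`x_0 y_0 + ... + x_(d-1) y_(d-1) - x_d y_d`. -/
def lorentz {d : ℕ} (x y : Fin (d + 1) → ℝ) : ℝ :=
  (∑ i : Fin d, x i.castSucc * y i.castSucc) - x (Fin.last d) * y (Fin.last d)

/-- The hyperboloid model of `d`-dimensional hyperbolic space: the component of
`{x | lorentz x x = -1}` that contains `(0, ..., 0, 1)`. -/
structure Hyp (d : ℕ) where
  val : Fin (d + 1) → ℝ
  lorentz_self : lorentz val val = -1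
  last_pos : 0 < val (Fin.last d)

section Lemmas

variable {d : ℕ}

theorem lorentz_comm (x y : Fin (d + 1) → ℝ) : lorentz x y = lorentz y x := by
  simp [lorentz, mul_comm]

theorem lorentz_add_left (x x' y : Fin (d + 1) → ℝ) :
    lorentz (x + x') y = lorentz x y + lorentz x' y := by
  simp only [lorentz, Pi.add_apply, add_mul, Finset.sum_add_distrib]; ring

theorem lorentz_smul_left (c : ℝ) (x y : Fin (d + 1) → ℝ) :
    lorentz (c • x) y = c * lorentz x y := by
  simp only [lorentz, Pi.smul_apply, smul_eq_mul, mul_assoc, ← Finset.mul_sum]; ring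

theorem lorentz_add_right (x y y' : Fin (d + 1) → ℝ) :
    lorentz x (y + y') = lorentz x y + lorentz x y' := by
  rw [lorentz_comm, lorentz_add_left, lorentz_comm y, lorentz_comm y']

theorem lorentz_smul_right (c : ℝ) (x y : Fin (d + 1) → ℝ) :
    lorentz x (c • y) = c * lorentz x y := by
  rw [lorentz_comm, lorentz_smul_left, lorentz_comm]

theorem Hyp.ext_val {x y : Hyp d} (h : x.val = y.val) : x = y := by
  cases x; cases y; cases h; rfl

theorem Hyp.sum_sq (x : Hyp d) :
    ∑ i : Fin d, x.val i.castSucc ^ 2 = x.val (Fin.last d) ^ 2 - 1 := by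
  have h := x.lorentz_self
  simp only [lorentz, ← pow_two] at h
  linarith

theorem Hyp.one_le_last (x : Hyp d) : 1 ≤ x.val (Fin.last d) := by
  have h : 0 ≤ ∑ i : Fin d, x.val i.castSucc ^ 2 := Finset.sum_nonneg fun i _ => sq_nonneg _
  rw [x.sum_sq] at h
  nlinarith [x.last_pos]

theorem Hyp.one_le_neg_lorentz (x y : Hyp d) : 1 ≤ -lorentz x.val y.val := by
  have h := Finset.sum_mul_sq_le_sq_mul_sq Finset.univ
    (fun i : Fin d => x.val i.castSucc) (fun i : Fin d => y.val i.castSucc)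
  rw [x.sum_sq, y.sum_sq] at h
  have hx := x.one_le_last
  have hy := y.one_le_last
  unfold lorentz
  set a := x.val (Fin.last d)
  set b := y.val (Fin.last d)
  set s := ∑ i : Fin d, x.val i.castSucc * y.val i.castSucc
  have hab : 0 ≤ a * b - 1 := by nlinarith
  have : s ≤ a * b - 1 := abs_le_of_sq_le_sq' (by nlinarith [sq_nonneg (a - b)]) hab |>.2
  linarith

theorem Hyp.eq_of_lorentz (x y : Hyp d) (hxy : lorentz x.val y.val = -1) : x = y := by
  have h := Finset.sum_mul_sq_le_sq_mul_sq Finset.univ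
    (fun i : Fin d => x.val i.castSucc) (fun i : Fin d => y.val i.castSucc)
  rw [x.sum_sq, y.sum_sq] at h
  have hs : ∑ i : Fin d, (x.val i.castSucc - y.val i.castSucc) ^ 2 =
      (x.val (Fin.last d) - y.val (Fin.last d)) ^ 2 := by
    have : ∀ i : Fin d, (x.val i.castSucc - y.val i.castSucc) ^ 2 =
        x.val i.castSucc ^ 2 + y.val i.castSucc ^ 2
          - 2 * (x.val i.castSucc * y.val i.castSucc) := fun i => by ring
    simp only [this, Finset.sum_sub_distrib, Finset.sum_add_distrib, x.sum_sq, y.sum_sq,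
      ← Finset.mul_sum]
    unfold lorentz at hxy
    nlinarith
  have h0 : (x.val (Fin.last d) - y.val (Fin.last d)) ^ 2 = 0 := by
    unfold lorentz at hxy
    have e : ∑ i : Fin d, x.val i.castSucc * y.val i.castSucc =
        x.val (Fin.last d) * y.val (Fin.last d) - 1 := by linarith
    rw [e] at h
    nlinarith [sq_nonneg (x.val (Fin.last d) - y.val (Fin.last d))]
  rw [h0, Finset.sum_eq_zero_iff_of_nonneg fun i _ => sq_nonneg _] at hs
  apply Hyp.ext_val
  funext j
  refine Fin.lastCases ?_ (fun i => ?_) j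
  · exact sub_eq_zero.1 (pow_eq_zero_iff two_ne_zero |>.1 h0)
  · exact sub_eq_zero.1 (pow_eq_zero_iff two_ne_zero |>.1 (hs i (Finset.mem_univ i)))

theorem Hyp.lorentz_nonneg_of_orthogonal (y : Hyp d) (v : Fin (d + 1) → ℝ)
    (hv : lorentz v y.val = 0) : 0 ≤ lorentz v v := by
  have h := Finset.sum_mul_sq_le_sq_mul_sq Finset.univ
    (fun i : Fin d => v i.castSucc) (fun i : Fin d => y.val i.castSucc)
  rw [y.sum_sq] at h
  have hy := y.one_le_last
  unfold lorentz at hv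
  simp only [lorentz, ← pow_two]
  rw [sub_eq_zero.1 hv] at h
  have hn : 0 ≤ ∑ i : Fin d, v i.castSucc ^ 2 := Finset.sum_nonneg fun i _ => sq_nonneg _
  set N := ∑ i : Fin d, v i.castSucc ^ 2
  have hb : 0 < y.val (Fin.last d) ^ 2 := by positivity
  have : v (Fin.last d) ^ 2 * y.val (Fin.last d) ^ 2 ≤ N * y.val (Fin.last d) ^ 2 := by
    nlinarith
  linarith [le_of_mul_le_mul_right this hb]

theorem Hyp.lorentz_triangle (x y z : Hyp d) :
    (lorentz x.val y.val * lorentz y.val z.val + lorentz x.val z.val) ^ 2 ≤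
      (lorentz x.val y.val ^ 2 - 1) * (lorentz y.val z.val ^ 2 - 1) := by
  have key : ∀ t : ℝ, 0 ≤ (lorentz y.val z.val ^ 2 - 1) * (t * t) +
      (2 * (lorentz x.val y.val * lorentz y.val z.val + lorentz x.val z.val)) * t +
      (lorentz x.val y.val ^ 2 - 1) := by
    intro t
    have hyy := y.lorentz_self
    have hxx := x.lorentz_self
    have hzz := z.lorentz_self
    have h := y.lorentz_nonneg_of_orthogonal
      ((x.val + lorentz x.val y.val • y.val) + t • (z.val + lorentz y.val z.val • y.val)) (by
        simp only [lorentz_add_left, lorentz_smul_left, hyy, lorentz_comm z.val y.val]; ring)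
    simp only [lorentz_add_left, lorentz_smul_left, lorentz_add_right, lorentz_smul_right,
      hyy, hxx, hzz, lorentz_comm z.val y.val, lorentz_comm y.val x.val,
      lorentz_comm z.val x.val] at h
    linarith
  have := discrim_le_zero key
  unfold discrim at this
  nlinarith

end Lemmas

/-- The hyperbolic metric: `cosh (dist x y) = - lorentz x y`. -/
noncomputable instance instMetricSpaceHyp (d : ℕ) : MetricSpace (Hyp d) where
  dist x y := Real.arcosh (-lorentz x.val y.val)
  dist_self x := by simp [x.lorentz_self]
  dist_comm x y := by rw [lorentz_comm]
  dist_triangle x y z := by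
    have hp := x.one_le_neg_lorentz y
    have hq := y.one_le_neg_lorentz z
    have hr := x.one_le_neg_lorentz z
    have ht := Hyp.lorentz_triangle x y z
    have hA := Real.arcosh_nonneg hp
    have hB := Real.arcosh_nonneg hq
    rw [← Real.arcosh_cosh (add_nonneg hA hB), Real.arcosh_le_arcosh (by linarith)
      (Real.cosh_pos _), Real.cosh_add, Real.cosh_arcosh hp, Real.cosh_arcosh hq,
      Real.sinh_arcosh hp, Real.sinh_arcosh hq, ← Real.sqrt_mul (by nlinarith)]
    have := Real.abs_le_sqrt (y := ((-lorentz x.val y.val) ^ 2 - 1) *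
      ((-lorentz y.val z.val) ^ 2 - 1)) (by simpa using ht)
    linarith [(abs_le.1 this).1]
  eq_of_dist_eq_zero {x y} h := by
    have := (Real.arcosh_eq_zero_iff (x.one_le_neg_lorentz y)).1 h
    exact Hyp.eq_of_lorentz x y (by linarith)

/-- The Möbius group `M(n)`: the isometry group of hyperbolic `(n+1)`-space. -/
abbrev Moebius (n : ℕ) : Type := Hyp (n + 1) ≃ᵢ Hyp (n + 1)

/-- `M(n)` carries the topology of pointwise convergence. For isometries this is the same as the
compact-open topology, and it is the Lie group topology. -/
noncomputable instance instTopologicalSpaceMoebius (n : ℕ) : TopologicalSpace (Moebius n) :=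
  TopologicalSpace.induced (fun (f : Moebius n) (x : Hyp (n + 1)) => f x) inferInstance

theorem Moebius.tendsto_iff {n : ℕ} {α : Type*} {l : Filter α} {F : α → Moebius n}
    {f : Moebius n} : Filter.Tendsto F l (nhds f) ↔
      ∀ x, Filter.Tendsto (fun a => dist (F a x) (f x)) l (nhds 0) := by
  rw [nhds_induced, Filter.tendsto_comap_iff, tendsto_pi_nhds]
  exact forall_congr' fun x => tendsto_iff_dist_tendsto_zero

instance instIsTopologicalGroupMoebius (n : ℕ) : IsTopologicalGroup (Moebius n) where
  continuous_mul := by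
    rw [continuous_iff_continuousAt]
    rintro ⟨f, g⟩
    refine Moebius.tendsto_iff.2 fun x => ?_
    have h1 := Moebius.tendsto_iff.1 (continuous_fst.tendsto (f, g)) (g x)
    have h2 := Moebius.tendsto_iff.1 (continuous_snd.tendsto (f, g)) x
    refine squeeze_zero (fun _ => dist_nonneg) (fun p => ?_) (by simpa using h2.add h1)
    calc dist ((p.1 * p.2) x) ((f * g) x) = dist (p.1 (p.2 x)) (f (g x)) := rfl
      _ ≤ dist (p.1 (p.2 x)) (p.1 (g x)) + dist (p.1 (g x)) (f (g x)) := dist_triangle _ _ _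
      _ = _ := by rw [p.1.dist_eq]
  continuous_inv := by
    rw [continuous_iff_continuousAt]
    intro f
    refine Moebius.tendsto_iff.2 fun x => ?_
    have h := Moebius.tendsto_iff.1 (continuous_id.tendsto f) (f⁻¹ x)
    refine h.congr fun g => ?_
    have e : f (f⁻¹ x) = x := f.apply_symm_apply x
    have e' : g (g⁻¹ x) = x := g.apply_symm_apply x
    calc dist (g (f⁻¹ x)) (f (f⁻¹ x)) = dist (g (f⁻¹ x)) (g (g⁻¹ x)) := by rw [e, e']
      _ = dist (f⁻¹ x) (g⁻¹ x) := g.dist_eq _ _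
      _ = dist (g⁻¹ x) (f⁻¹ x) := dist_comm _ _

/-- `M_o(n)`: the identity component of `M(n)`. -/
noncomputable abbrev MoebiusO (n : ℕ) : Subgroup (Moebius n) := Subgroup.connectedComponentOfOne (Moebius n)

/-- `SO(d, 1)`: the linear automorphisms of `ℝ^(d+1)` of determinant `1` that preserve the
Lorentz form. -/
def SO (d : ℕ) : Subgroup (GL (Fin (d + 1)) ℝ) where
  carrier := {A | A.val.det = 1 ∧
    ∀ x y : Fin (d + 1) → ℝ, lorentz (A.val.mulVec x) (A.val.mulVec y) = lorentz x y}
  one_mem' := by simp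
  mul_mem' := by
    rintro A B ⟨hA, hA'⟩ ⟨hB, hB'⟩
    refine ⟨by simp [hA, hB], fun x y => ?_⟩
    simp only [Units.val_mul, ← Matrix.mulVec_mulVec, hA', hB']
  inv_mem' := by
    rintro A ⟨hA, hA'⟩
    refine ⟨?_, fun x y => ?_⟩
    · have h : (A.val * (A⁻¹).val).det = 1 := by rw [Units.mul_inv, Matrix.det_one]
      rwa [Matrix.det_mul, hA, one_mul] at h
    · rw [← hA' ((A⁻¹).val.mulVec x), Matrix.mulVec_mulVec, Matrix.mulVec_mulVec,
        Units.mul_inv, Matrix.one_mulVec, Matrix.one_mulVec]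

/-- `SO_o(d, 1)`: the identity component of `SO(d, 1)`. -/
abbrev SOo (d : ℕ) : Subgroup (SO d) := Subgroup.connectedComponentOfOne (SO d)

/-- An element `g` of a group `G` is real if it is conjugate in `G` to its inverse. -/
def IsRealElement {G : Type*} [Group G] (g : G) : Prop := ∃ h : G, h * g * h⁻¹ = g⁻¹

end MoebiusReal

/-!
Write `d = n + 1`, so that the Lorentz form lives on `ℝ^(d+1)`.

**The isomorphism.** An isometry of the hyperboloid preserves the Lorentz form between its points,
so it is the restriction of a unique linear map preserving the form (`linExt`). Both restriction and
extension are continuous, the determinant of an extension is `1` or `-1`, and a form-preserving map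
sends the base point to a vector whose last coordinate is nonzero. Hence each of the two maps sends
the identity component into the identity component, and they are inverse to each other
(`equivMoebiusO`). By Cartan–Dieudonné, a form-preserving map that preserves the upper sheet is a
product of reflections in spacelike vectors; these vectors form a connected set for `d ≥ 2`, so
`SO_o(d, 1)` consists of all elements of `SO(d, 1)` that preserve the upper sheet (`mem_SOo_iff`).

**Reality.** Every Lorentz transformation `f` has a reverser `h`, that is, `h f h⁻¹ = f⁻¹`, of
determinant `(-1) ^ ((d + 1) / 2)` (`IsLorentz.exists_reverser`). The building block is this: if `v`
is an eigenvector of `f + f⁻¹`, then the span of `v` and `f v` is invariant, and the reflection in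
`f v - v` swaps `v` and `f v` and reverses `f` on the span. Minimizing the displacement over the
hyperboloid yields a timelike eigenvector of `f + f⁻¹`, with span of dimension `1` or `2`, or a
null eigenvector of `f`. In the latter case either there is still a timelike eigenvector of
`f + f⁻¹`, or the null vector is fixed and the Fitting decomposition of `f - 1` yields an invariant
subspace of dimension `3` on which one reflection reverses `f`. The orthogonal complement of each of
these subspaces is positive definite; it splits into invariant planes, each contributing one
reflection, and lines, whose contribution is free. In all cases the number of reflections can be
taken congruent to `(d + 1) / 2` modulo `2`.

Conversely, a product of rotations by different angles in the coordinate planes `{2k, 2k + 1}`, with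
a boost in the last plane if `d` is odd, can be reversed only by maps that preserve each of these
planes with negative determinant, so the sign of the determinant of a reverser is forced
(`det_reverser_gen`). Hence all elements are real if and only if `(d + 1) / 2 = (n + 2) / 2`
(rounded down) is even, that is, `n ≡ 2` or `3` modulo `4`.
-/

namespace MoebiusReal

/-! ### The Lorentz form, Lorentz transformations and reflections -/

section LorentzForm

variable {d : ℕ}

/-- The Lorentz form as a bilinear form. -/
def lorentzForm (d : ℕ) : LinearMap.BilinForm ℝ (Fin (d + 1) → ℝ) :=
  LinearMap.mk₂ ℝ lorentz lorentz_add_left lorentz_smul_left lorentz_add_right lorentz_smul_right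

@[simp] theorem lorentzForm_apply (x y : Fin (d + 1) → ℝ) : lorentzForm d x y = lorentz x y := rfl

@[simp] theorem lorentz_zero_left (x : Fin (d + 1) → ℝ) : lorentz 0 x = 0 :=
  LinearMap.map_zero₂ (lorentzForm d) x

@[simp] theorem lorentz_zero_right (x : Fin (d + 1) → ℝ) : lorentz x 0 = 0 :=
  (lorentzForm d x).map_zero

theorem lorentz_neg_left (x y : Fin (d + 1) → ℝ) : lorentz (-x) y = -lorentz x y :=
  LinearMap.map_neg₂ (lorentzForm d) x y

theorem lorentz_neg_right (x y : Fin (d + 1) → ℝ) : lorentz x (-y) = -lorentz x y :=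
  (lorentzForm d x).map_neg y

theorem lorentz_sub_left (x x' y : Fin (d + 1) → ℝ) :
    lorentz (x - x') y = lorentz x y - lorentz x' y :=
  LinearMap.map_sub₂ (lorentzForm d) x x' y

theorem lorentz_sub_right (x y y' : Fin (d + 1) → ℝ) :
    lorentz x (y - y') = lorentz x y - lorentz x y' :=
  (lorentzForm d x).map_sub y y'

theorem lorentzForm_isRefl (d : ℕ) : (lorentzForm d).IsRefl := fun x y h => by
  rw [lorentzForm_apply, lorentz_comm]; exact h

theorem continuous_lorentz : Continuous fun p : (Fin (d + 1) → ℝ) × (Fin (d + 1) → ℝ) =>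
    lorentz p.1 p.2 := by
  unfold lorentz; fun_prop

/-- The base point `(0, ..., 0, 1)` of the hyperboloid. -/
def basePt (d : ℕ) : Fin (d + 1) → ℝ := Pi.single (Fin.last d) 1

@[simp] theorem basePt_castSucc (i : Fin d) : basePt d i.castSucc = 0 :=
  Pi.single_eq_of_ne (Fin.castSucc_lt_last i).ne _

@[simp] theorem basePt_last : basePt d (Fin.last d) = 1 := Pi.single_eq_same _ _

@[simp] theorem lorentz_basePt (x : Fin (d + 1) → ℝ) :
    lorentz x (basePt d) = -x (Fin.last d) := by
  simp [lorentz]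

theorem lorentz_single_castSucc (x : Fin (d + 1) → ℝ) (i : Fin d) :
    lorentz x (Pi.single i.castSucc 1) = x i.castSucc := by
  have h : ∀ j : Fin d, (Pi.single i.castSucc 1 : Fin (d + 1) → ℝ) j.castSucc =
      if j = i then 1 else 0 := fun j => by simp [Pi.single_apply]
  simp [lorentz, h]

theorem eq_zero_of_lorentz_eq_zero {x : Fin (d + 1) → ℝ} (h : ∀ y, lorentz x y = 0) : x = 0 := by
  funext j
  refine Fin.lastCases ?_ (fun i => ?_) j
  · simpa using h (basePt d)
  · rw [← lorentz_single_castSucc x, h]; rfl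

/-- The Lorentz form is positive definite on the orthogonal complement of a timelike vector. -/
theorem lorentz_pos_of_orthogonal {t x : Fin (d + 1) → ℝ} (ht : lorentz t t < 0)
    (hxt : lorentz x t = 0) (hx : x ≠ 0) : 0 < lorentz x x := by
  have h := Finset.sum_mul_sq_le_sq_mul_sq Finset.univ
    (fun i : Fin d => x i.castSucc) (fun i : Fin d => t i.castSucc)
  have hX : 0 ≤ ∑ i : Fin d, x i.castSucc ^ 2 := Finset.sum_nonneg fun i _ => sq_nonneg _
  have hT : 0 ≤ ∑ i : Fin d, t i.castSucc ^ 2 := Finset.sum_nonneg fun i _ => sq_nonneg _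
  simp only [lorentz, ← pow_two] at ht hxt ⊢
  rw [sub_eq_zero.1 hxt] at h
  have ht0 : t (Fin.last d) ≠ 0 := by rintro h0; rw [h0] at ht; nlinarith
  rcases hX.eq_or_lt with h0 | hpos
  · exfalso
    apply hx
    have h1 : (x (Fin.last d) * t (Fin.last d)) ^ 2 = 0 :=
      le_antisymm (by rw [← h0, zero_mul] at h; exact h) (sq_nonneg _)
    have h2 := (Finset.sum_eq_zero_iff_of_nonneg fun i _ => sq_nonneg _).1 h0.symm
    funext j
    refine Fin.lastCases ?_ (fun i => ?_) j
    · simpa [ht0] using h1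
    · simpa using h2 i (Finset.mem_univ i)
  · have htp : 0 < t (Fin.last d) ^ 2 := by positivity
    have : x (Fin.last d) ^ 2 * t (Fin.last d) ^ 2 <
        (∑ i : Fin d, x i.castSucc ^ 2) * t (Fin.last d) ^ 2 := by nlinarith
    linarith [lt_of_mul_lt_mul_right this htp.le]

theorem last_ne_zero_of_lorentz_nonpos {u : Fin (d + 1) → ℝ} (hu : lorentz u u ≤ 0) (hu0 : u ≠ 0) :
    u (Fin.last d) ≠ 0 := fun h0 => by
  have := lorentz_pos_of_orthogonal (t := basePt d) (by simp) (by simp [h0]) hu0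
  linarith

/-- On the orthogonal complement of a null vector `u` the Lorentz form is positive semidefinite
with radical spanned by `u`. -/
theorem lorentz_pos_or_eq_smul_of_orthogonal {u x : Fin (d + 1) → ℝ} (hu : lorentz u u = 0)
    (hu0 : u ≠ 0) (hxu : lorentz x u = 0) : 0 < lorentz x x ∨ ∃ c : ℝ, x = c • u := by
  have hl := last_ne_zero_of_lorentz_nonpos hu.le hu0
  set c := x (Fin.last d) / u (Fin.last d) with hc
  by_cases h : x - c • u = 0
  · exact Or.inr ⟨c, sub_eq_zero.1 h⟩
  · left
    have h1 := lorentz_pos_of_orthogonal (t := basePt d) (x := x - c • u) (by simp)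
      (by simp [hc]; field_simp; ring) h
    simpa [lorentz_sub_left, lorentz_sub_right, lorentz_smul_left, lorentz_smul_right, hu, hxu,
      lorentz_comm u x] using h1

theorem eq_smul_of_null {u x : Fin (d + 1) → ℝ} (hu : lorentz u u = 0)
    (hu0 : u ≠ 0) (hxu : lorentz x u = 0) (hx : lorentz x x ≤ 0) : ∃ c : ℝ, x = c • u :=
  (lorentz_pos_or_eq_smul_of_orthogonal hu hu0 hxu).resolve_left hx.not_gt

/-- Two causal vectors on the same side have nonpositive product. -/
theorem lorentz_nonpos_of_causal {x y : Fin (d + 1) → ℝ} (hx : lorentz x x ≤ 0)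
    (hy : lorentz y y ≤ 0) (hx' : 0 ≤ x (Fin.last d)) (hy' : 0 ≤ y (Fin.last d)) :
    lorentz x y ≤ 0 := by
  have h := Finset.sum_mul_sq_le_sq_mul_sq Finset.univ
    (fun i : Fin d => x i.castSucc) (fun i : Fin d => y i.castSucc)
  have hY : 0 ≤ ∑ i : Fin d, y i.castSucc ^ 2 := Finset.sum_nonneg fun i _ => sq_nonneg _
  simp only [lorentz, ← pow_two] at hx hy ⊢
  have h2 : (∑ i : Fin d, x i.castSucc ^ 2) * ∑ i : Fin d, y i.castSucc ^ 2 ≤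
      x (Fin.last d) ^ 2 * y (Fin.last d) ^ 2 :=
    mul_le_mul (by linarith) (by linarith) hY (sq_nonneg _)
  have := abs_le_of_sq_le_sq' (h.trans (h2.trans_eq (mul_pow _ _ 2).symm)) (mul_nonneg hx' hy')
  linarith [this.2]

end LorentzForm

section Isometries

variable {d : ℕ}

/-- A linear map is an orthochronous Lorentz transformation if it preserves the Lorentz form and
the upper sheet of the hyperboloid. The second condition is stated at the base point only; this
is enough by `IsLorentz.last_pos`. -/
structure IsLorentz (f : Module.End ℝ (Fin (d + 1) → ℝ)) : Prop where
  map_lorentz : ∀ x y, lorentz (f x) (f y) = lorentz x y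
  basePt_pos : 0 < f (basePt d) (Fin.last d)

namespace IsLorentz

variable {f g : Module.End ℝ (Fin (d + 1) → ℝ)}

theorem last_nonneg (hf : IsLorentz f) {x : Fin (d + 1) → ℝ} (hx : lorentz x x ≤ 0)
    (hx' : 0 ≤ x (Fin.last d)) : 0 ≤ f x (Fin.last d) := by
  by_contra! h
  have h1 := lorentz_nonpos_of_causal (x := -f x) (y := f (basePt d))
    (by simpa [lorentz_neg_left, lorentz_neg_right, hf.map_lorentz] using hx)
    (by simp [hf.map_lorentz]) (by simpa using h.le) hf.basePt_pos.le
  rw [lorentz_neg_left, hf.map_lorentz, lorentz_basePt] at h1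
  have h0 : x = 0 := by
    by_contra h0
    exact last_ne_zero_of_lorentz_nonpos hx h0 (by linarith)
  simp [h0] at h

theorem injective (hf : IsLorentz f) : Function.Injective f := by
  rw [injective_iff_map_eq_zero]
  intro x hx
  refine eq_zero_of_lorentz_eq_zero fun y => ?_
  rw [← hf.map_lorentz, hx, lorentz_zero_left]

theorem surjective (hf : IsLorentz f) : Function.Surjective f :=
  LinearMap.injective_iff_surjective.1 hf.injective

theorem map_surjOn (hf : IsLorentz f) {W : Submodule ℝ (Fin (d + 1) → ℝ)}
    (hfW : ∀ x ∈ W, f x ∈ W) : ∀ w ∈ W, ∃ y ∈ W, f y = w := fun w hw => by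
  have hi : Function.Injective (f.restrict hfW) := fun a b hab =>
    Subtype.ext (hf.injective (congrArg Subtype.val hab))
  obtain ⟨y, hy⟩ := LinearMap.injective_iff_surjective.1 hi ⟨w, hw⟩
  exact ⟨y.1, y.2, congrArg Subtype.val hy⟩

theorem last_pos (hf : IsLorentz f) {x : Fin (d + 1) → ℝ} (hx : lorentz x x ≤ 0)
    (hx' : 0 < x (Fin.last d)) : 0 < f x (Fin.last d) := by
  refine (hf.last_nonneg hx hx'.le).lt_of_ne' (last_ne_zero_of_lorentz_nonpos ?_ ?_)
  · rwa [hf.map_lorentz]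
  · rw [Ne, hf.injective.eq_iff' (map_zero f)]
    rintro rfl
    simp at hx'

theorem one : IsLorentz (1 : Module.End ℝ (Fin (d + 1) → ℝ)) := ⟨fun _ _ => rfl, by simp⟩

theorem mul (hf : IsLorentz f) (hg : IsLorentz g) : IsLorentz (f * g) :=
  ⟨fun x y => by simp [hf.map_lorentz, hg.map_lorentz],
    hf.last_pos (by simp [hg.map_lorentz]) hg.basePt_pos⟩

/-- A causal vector and its image lie on the same side of the light cone. -/
theorem lorentz_apply_nonpos (hf : IsLorentz f) {x : Fin (d + 1) → ℝ} (hx : lorentz x x ≤ 0) :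
    lorentz (f x) x ≤ 0 := by
  rcases le_total 0 (x (Fin.last d)) with h | h
  · exact lorentz_nonpos_of_causal (by rwa [hf.map_lorentz]) hx (hf.last_nonneg hx h) h
  · have hx2 : lorentz (-x) (-x) ≤ 0 := by simpa [lorentz_neg_left, lorentz_neg_right] using hx
    have h' : 0 ≤ (-x) (Fin.last d) := by simpa using h
    have := lorentz_nonpos_of_causal (by rwa [hf.map_lorentz]) hx2 (hf.last_nonneg hx2 h') h'
    simpa [lorentz_neg_left, lorentz_neg_right] using this

theorem lorentz_apply_neg (hf : IsLorentz f) {x : Fin (d + 1) → ℝ} (hx : lorentz x x < 0) :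
    lorentz (f x) x < 0 := by
  refine (hf.lorentz_apply_nonpos hx.le).lt_of_ne fun h0 => ?_
  have hne : f x ≠ 0 := by
    rw [Ne, hf.injective.eq_iff' (map_zero f)]
    rintro rfl
    simp at hx
  have := lorentz_pos_of_orthogonal hx h0 hne
  rw [hf.map_lorentz] at this
  linarith

/-- The displacement of a timelike vector under a Lorentz transformation is spacelike. -/
theorem displacement_pos_of_timelike (hf : IsLorentz f) {x : Fin (d + 1) → ℝ}
    (hx : lorentz x x < 0) (hne : f x ≠ x) : 0 < lorentz (f x - x) (f x - x) := by
  refine lorentz_pos_of_orthogonal (t := f x + x) ?_ ?_ (sub_ne_zero.2 hne)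
  · have := hf.lorentz_apply_neg hx
    simp only [lorentz_add_left, lorentz_add_right, hf.map_lorentz, lorentz_comm x (f x)]
    linarith
  · simp only [lorentz_add_right, lorentz_sub_left, hf.map_lorentz, lorentz_comm x (f x)]
    ring

end IsLorentz

/-- The reflection in the hyperplane orthogonal to `v`, for the Lorentz form. It is the identity
if `v` is null. -/
noncomputable def refl (v : Fin (d + 1) → ℝ) : Module.End ℝ (Fin (d + 1) → ℝ) :=
  LinearMap.transvection ((-2 / lorentz v v) • lorentzForm d v) v

theorem refl_apply (v x : Fin (d + 1) → ℝ) :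
    refl v x = x - (2 * lorentz v x / lorentz v v) • v := by
  simp [refl, LinearMap.transvection.apply, sub_eq_add_neg, ← neg_smul]
  congr 1; ring

theorem refl_apply_of_orthogonal {v x : Fin (d + 1) → ℝ} (h : lorentz x v = 0) :
    refl v x = x := by
  simp [refl_apply, lorentz_comm v x, h]

theorem refl_apply_self {v : Fin (d + 1) → ℝ} (hv : lorentz v v ≠ 0) : refl v v = -v := by
  rw [refl_apply, mul_div_assoc, div_self hv]; module

theorem lorentz_refl {v : Fin (d + 1) → ℝ} (hv : lorentz v v ≠ 0) (x y : Fin (d + 1) → ℝ) :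
    lorentz (refl v x) (refl v y) = lorentz x y := by
  simp only [refl_apply, lorentz_sub_left, lorentz_sub_right, lorentz_smul_left,
    lorentz_smul_right, lorentz_comm x v]
  field_simp
  ring

theorem isLorentz_refl {v : Fin (d + 1) → ℝ} (hv : 0 < lorentz v v) : IsLorentz (refl v) where
  map_lorentz := lorentz_refl hv.ne'
  basePt_pos := by
    simp only [refl_apply, lorentz_basePt, Pi.sub_apply, basePt_last, Pi.smul_apply, smul_eq_mul]
    have : 0 ≤ 2 * v (Fin.last d) ^ 2 / lorentz v v := by positivity
    have e : 2 * -v (Fin.last d) / lorentz v v * v (Fin.last d) =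
      -(2 * v (Fin.last d) ^ 2 / lorentz v v) := by ring
    rw [e]; linarith

theorem refl_refl {v : Fin (d + 1) → ℝ} (hv : lorentz v v ≠ 0) : refl v * refl v = 1 := by
  ext1 x
  refine LinearMap.ext fun c => ?_
  simp only [Module.End.mul_apply, LinearMap.comp_apply, refl_apply, lorentz_sub_right,
    lorentz_smul_right, Module.End.one_apply]
  rw [sub_sub, ← add_smul]
  convert sub_zero _
  rw [← zero_smul ℝ v]
  congr 1
  field_simp
  ring

theorem det_refl {v : Fin (d + 1) → ℝ} (hv : lorentz v v ≠ 0) : LinearMap.det (refl v) = -1 := by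
  rw [refl, LinearMap.transvection.det]
  simp only [LinearMap.smul_apply, lorentzForm_apply, smul_eq_mul]
  field_simp
  ring

/-- Two vectors of the same length are swapped by the reflection in their difference. -/
theorem refl_sub_apply {x y : Fin (d + 1) → ℝ} (hxy : lorentz x x = lorentz y y)
    (h : lorentz (y - x) (y - x) ≠ 0) : refl (y - x) x = y := by
  have e : lorentz (y - x) (y - x) = -2 * lorentz (y - x) x := by
    simp only [lorentz_sub_left, lorentz_sub_right, lorentz_comm x y]; linarith
  have h2 : lorentz (y - x) x ≠ 0 := fun h0 => h (by rw [e, h0, mul_zero])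
  have : 2 * lorentz (y - x) x / (-2 * lorentz (y - x) x) = -1 := by field_simp
  rw [refl_apply, e, this]; module

theorem refl_sub_apply' {x y : Fin (d + 1) → ℝ} (hxy : lorentz x x = lorentz y y)
    (h : lorentz (y - x) (y - x) ≠ 0) : refl (y - x) y = x := by
  have := congrArg (fun g : Module.End ℝ (Fin (d + 1) → ℝ) => g x) (refl_refl h)
  rwa [Module.End.mul_apply, refl_sub_apply hxy h] at this

end Isometries

/-! ### Generation by reflections and the identity component -/

section Reflections

variable {d : ℕ}

/-- Cartan–Dieudonné for Lorentz transformations that fix the base point: each nonzero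
displacement of a standard basis vector is spacelike, and reflecting in it fixes one more basis
vector. -/
theorem exists_list_refl_of_fixes (k : ℕ) : ∀ f : Module.End ℝ (Fin (d + 1) → ℝ), IsLorentz f →
    f (basePt d) = basePt d →
    (∀ i : Fin d, i.val + k < d → f (Pi.single i.castSucc 1) = Pi.single i.castSucc 1) →
    ∃ l : List (Fin (d + 1) → ℝ), (∀ v ∈ l, 0 < lorentz v v) ∧ f = (l.map refl).prod := by
  induction k with
  | zero =>
    intro f _ h0 h1
    refine ⟨[], by simp, ?_⟩
    simp only [List.map_nil, List.prod_nil]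
    refine LinearMap.pi_ext' fun j => LinearMap.ext_ring ?_
    refine Fin.lastCases ?_ (fun i => ?_) j
    · exact h0
    · exact h1 i (by simp)
  | succ k ih =>
    intro f hf h0 h1
    by_cases hk : k < d
    swap
    · exact ih f hf h0 fun i hi => absurd hi (by omega)
    let i : Fin d := ⟨d - 1 - k, by omega⟩
    set e : Fin (d + 1) → ℝ := Pi.single i.castSucc 1
    by_cases hfe : f e = e
    · refine ih f hf h0 fun j hj => ?_
      by_cases hji : j = i
      · rw [hji]; exact hfe
      · have hne : j.val ≠ d - 1 - k := fun h => hji (Fin.ext h)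
        exact h1 j (by omega)
    · have heo : lorentz e (basePt d) = 0 := by
        simp [e]
      have hor : ∀ x, f x = x → lorentz e x = 0 → lorentz x (f e - e) = 0 := fun x hx hex => by
        have : lorentz x (f e) = lorentz x e := by rw [← hf.map_lorentz x e, hx]
        rw [lorentz_sub_right, this, sub_self]
      have hpos : 0 < lorentz (f e - e) (f e - e) :=
        lorentz_pos_of_orthogonal (t := basePt d) (by simp)
          (by rw [lorentz_comm]; exact hor _ h0 heo) (sub_ne_zero.2 hfe)
      obtain ⟨l, hl, hfl⟩ := ih (refl (f e - e) * f) ((isLorentz_refl hpos).mul hf)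
        (by rw [Module.End.mul_apply, h0, refl_apply_of_orthogonal (hor _ h0 heo)])
        (fun j hj => by
          by_cases hji : j = i
          · rw [hji]
            exact refl_sub_apply' (hf.map_lorentz e e).symm hpos.ne'
          · have hne : j.val ≠ d - 1 - k := fun h => hji (Fin.ext h)
            have h2 := h1 j (by omega)
            rw [Module.End.mul_apply, h2, refl_apply_of_orthogonal (hor _ h2 ?_)]
            rw [lorentz_single_castSucc]
            exact Pi.single_eq_of_ne (by simpa using hji) _)
      refine ⟨(f e - e) :: l, by simpa using ⟨hpos, hl⟩, ?_⟩
      rw [List.map_cons, List.prod_cons, ← hfl, ← mul_assoc, refl_refl hpos.ne', one_mul]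

/-- Cartan–Dieudonné: every orthochronous Lorentz transformation is a product of reflections in
spacelike vectors. -/
theorem IsLorentz.exists_list_refl {f : Module.End ℝ (Fin (d + 1) → ℝ)} (hf : IsLorentz f) :
    ∃ l : List (Fin (d + 1) → ℝ), (∀ v ∈ l, 0 < lorentz v v) ∧ f = (l.map refl).prod := by
  by_cases h : f (basePt d) = basePt d
  · exact exists_list_refl_of_fixes d f hf h fun i hi => absurd hi (by omega)
  · have hpos := hf.displacement_pos_of_timelike (x := basePt d) (by simp) h
    obtain ⟨l, hl, hfl⟩ := exists_list_refl_of_fixes d _ ((isLorentz_refl hpos).mul hf)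
      (refl_sub_apply' (hf.map_lorentz _ _).symm hpos.ne') fun i hi => absurd hi (by omega)
    refine ⟨(f (basePt d) - basePt d) :: l, by simpa using ⟨hpos, hl⟩, ?_⟩
    rw [List.map_cons, List.prod_cons, ← hfl, ← mul_assoc, refl_refl hpos.ne', one_mul]

theorem det_prod_refl (l : List (Fin (d + 1) → ℝ)) (hl : ∀ v ∈ l, 0 < lorentz v v) :
    LinearMap.det (l.map refl).prod = (-1) ^ l.length := by
  induction l with
  | nil => simp
  | cons v l ih =>
    rw [List.map_cons, List.prod_cons, map_mul, ih fun w hw => hl w (List.mem_cons_of_mem _ hw),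
      det_refl (hl v List.mem_cons_self).ne', List.length_cons, pow_succ, mul_comm]

end Reflections

section IdentityComponent

variable {d : ℕ}

/-- The inclusion of `SO(d, 1)` into the linear endomorphisms of `ℝ^(d+1)`. -/
noncomputable def toEnd (d : ℕ) : SO d →* Module.End ℝ (Fin (d + 1) → ℝ) :=
  ((Matrix.toLinAlgEquiv' : Matrix (Fin (d + 1)) (Fin (d + 1)) ℝ ≃ₐ[ℝ] _) : _ →* _).comp
    ((Units.coeHom _).comp (SO d).subtype)

theorem toEnd_apply (A : SO d) (x : Fin (d + 1) → ℝ) : toEnd d A x = A.1.val.mulVec x := rfl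

theorem toEnd_injective : Function.Injective (toEnd d) := fun _ _ h =>
  Subtype.ext (Units.ext (Matrix.toLinAlgEquiv'.injective h))

theorem det_toEnd (A : SO d) : LinearMap.det (toEnd d A) = 1 :=
  (LinearMap.det_toLin' A.1.val).trans A.2.1

theorem lorentz_toEnd (A : SO d) (x y : Fin (d + 1) → ℝ) :
    lorentz (toEnd d A x) (toEnd d A y) = lorentz x y := A.2.2 x y

/-- The element of `SO(d, 1)` given by a linear map. -/
noncomputable def ofEnd (f : Module.End ℝ (Fin (d + 1) → ℝ)) (hdet : LinearMap.det f = 1)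
    (hf : ∀ x y, lorentz (f x) (f y) = lorentz x y) : SO d :=
  ⟨⟨LinearMap.toMatrix' f, (LinearMap.toMatrix' f).adjugate,
    by rw [Matrix.mul_adjugate, LinearMap.det_toMatrix', hdet, one_smul],
    by rw [Matrix.adjugate_mul, LinearMap.det_toMatrix', hdet, one_smul]⟩,
    by simpa using hdet, fun x y => by simpa using hf x y⟩

@[simp] theorem toEnd_ofEnd (f : Module.End ℝ (Fin (d + 1) → ℝ)) (hdet : LinearMap.det f = 1)
    (hf : ∀ x y, lorentz (f x) (f y) = lorentz x y) : toEnd d (ofEnd f hdet hf) = f :=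
  LinearMap.ext fun x => by rw [toEnd_apply]; simp [ofEnd]

theorem continuous_toEnd_apply (x : Fin (d + 1) → ℝ) : Continuous fun A : SO d => toEnd d A x := by
  simp only [toEnd_apply]
  exact (Units.continuous_val.comp continuous_subtype_val).matrix_mulVec continuous_const

/-- A family of elements of `SO(d, 1)` is continuous if it is pointwise continuous. -/
theorem continuous_SO {X : Type*} [TopologicalSpace X] {F : X → SO d}
    (h : ∀ x, Continuous fun t => toEnd d (F t) x) : Continuous F := by
  have hv : Continuous fun t => (F t).1.val := by
    refine continuous_matrix fun i j => ?_
    have := (continuous_apply i).comp (h (Pi.single j 1))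
    simpa [Function.comp_def, toEnd_apply] using this
  refine Continuous.subtype_mk (Units.continuous_iff.2 ⟨hv, ?_⟩) _
  have e : (fun t => ((F t).1⁻¹).val) = fun t => (F t).1.val.adjugate := by
    funext t
    rw [Matrix.coe_units_inv, Matrix.inv_def, (F t).2.1]
    simp
  rw [e]
  exact hv.matrix_adjugate

/-- The spacelike vectors form a connected set if there are at least two space dimensions: they
are the pairs `(x, s * |x|)` with `x ≠ 0` and `|s| < 1`. -/
theorem isPreconnected_spacelike (hd : 2 ≤ d) :
    IsPreconnected {v : Fin (d + 1) → ℝ | 0 < lorentz v v} := by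
  have h1 : IsPreconnected ({0}ᶜ : Set (Fin d → ℝ)) := by
    refine (isConnected_compl_singleton_of_one_lt_rank ?_ 0).isPreconnected
    rw [rank_fin_fun]
    exact_mod_cast hd
  have hq : ∀ x : Fin d → ℝ, 0 ≤ ∑ i, x i ^ 2 := fun x => Finset.sum_nonneg fun i _ => sq_nonneg _
  have hq0 : ∀ x : Fin d → ℝ, x ≠ 0 → 0 < ∑ i, x i ^ 2 := fun x hx => by
    refine (hq x).lt_of_ne' fun h0 => hx ?_
    have := (Finset.sum_eq_zero_iff_of_nonneg fun i _ => sq_nonneg _).1 h0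
    funext i
    simpa using this i (Finset.mem_univ i)
  have h2 := (h1.prod (isPreconnected_Ioo (a := (-1 : ℝ)) (b := 1))).image
    (fun p : (Fin d → ℝ) × ℝ => (Fin.snoc p.1 (p.2 * √(∑ i, p.1 i ^ 2)) : Fin (d + 1) → ℝ))
    (Continuous.continuousOn (Continuous.finSnoc (by fun_prop) (by fun_prop)))
  convert h2
  ext v
  simp only [Set.mem_ofPred_eq, Set.mem_image, Set.mem_prod, Set.mem_compl_iff,
    Set.mem_singleton_iff, Set.mem_Ioo, Prod.exists]
  constructor
  · intro hv
    simp only [lorentz, ← pow_two] at hv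
    have hpos : 0 < ∑ i : Fin d, v i.castSucc ^ 2 := by nlinarith [sq_nonneg (v (Fin.last d))]
    have hs := Real.sqrt_pos.2 hpos
    refine ⟨fun i => v i.castSucc, v (Fin.last d) / √(∑ i : Fin d, v i.castSucc ^ 2),
      ⟨fun h0 => ?_, ?_⟩, ?_⟩
    · have : ∀ i : Fin d, v i.castSucc = 0 := fun i => congrFun h0 i
      simp [this] at hpos
    · rw [← abs_lt, abs_div, abs_of_pos hs, div_lt_one hs]
      exact Real.lt_sqrt_of_sq_lt (by rw [sq_abs]; linarith)
    · funext j
      refine Fin.lastCases ?_ (fun i => ?_) j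
      · simp only [Fin.snoc_last]; field_simp
      · simp only [Fin.snoc_castSucc]
  · rintro ⟨x, s, ⟨hx, hs⟩, rfl⟩
    simp only [lorentz, Fin.snoc_castSucc, Fin.snoc_last, ← pow_two, mul_pow, Real.sq_sqrt (hq x)]
    have hs2 : s ^ 2 < 1 := by rw [sq_lt_one_iff_abs_lt_one, abs_lt]; exact hs
    nlinarith [hq0 x hx]

/-- The product of two spacelike reflections lies in the identity component: move one of the two
vectors to the other within the spacelike vectors. -/
theorem mem_SOo_of_toEnd_eq_refl_mul_refl (hd : 2 ≤ d) {v w : Fin (d + 1) → ℝ}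
    (hv : 0 < lorentz v v) (hw : 0 < lorentz w w) {A : SO d}
    (hA : toEnd d A = refl v * refl w) : A ∈ SOo d := by
  have : PreconnectedSpace {v : Fin (d + 1) → ℝ // 0 < lorentz v v} :=
    isPreconnected_iff_preconnectedSpace.1 (isPreconnected_spacelike hd)
  let F : {v : Fin (d + 1) → ℝ // 0 < lorentz v v} → SO d := fun u =>
    ofEnd (refl u.1 * refl w) (by rw [map_mul, det_refl u.2.ne', det_refl hw.ne']; norm_num)
      ((isLorentz_refl u.2).mul (isLorentz_refl hw)).map_lorentz
  have hF : Continuous F := continuous_SO fun x => by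
    simp only [F, toEnd_ofEnd, Module.End.mul_apply]
    simp only [refl_apply (Subtype.val _)]
    have h1 (y : Fin (d + 1) → ℝ) :
        Continuous fun u : {v : Fin (d + 1) → ℝ // 0 < lorentz v v} => lorentz u.1 y :=
      continuous_lorentz.comp (continuous_subtype_val.prodMk continuous_const)
    have h2 : Continuous fun u : {v : Fin (d + 1) → ℝ // 0 < lorentz v v} => lorentz u.1 u.1 :=
      continuous_lorentz.comp (continuous_subtype_val.prodMk continuous_subtype_val)
    exact continuous_const.sub (((continuous_const.mul (h1 _)).div h2 fun u => u.2.ne').smul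
      continuous_subtype_val)
  have hF1 : F ⟨w, hw⟩ = 1 := toEnd_injective (by simp [F, refl_refl hw.ne'])
  have hFA : F ⟨v, hv⟩ = A := toEnd_injective (by simp [F, hA])
  exact (isPreconnected_range hF).subset_connectedComponent ⟨_, hF1⟩ ⟨_, hFA⟩

theorem mem_SOo_of_prod_refl (hd : 2 ≤ d) : ∀ (l : List (Fin (d + 1) → ℝ)) (A : SO d),
    (∀ v ∈ l, 0 < lorentz v v) → Even l.length → toEnd d A = (l.map refl).prod → A ∈ SOo d
  | [], A, _, _, h => by
    have : A = 1 := toEnd_injective (by simpa using h)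
    rw [this]; exact one_mem _
  | [_], _, _, h, _ => by simp at h
  | v :: w :: l, A, hl, he, h => by
    have hv := hl v (by simp)
    have hw := hl w (by simp)
    let B : SO d := ofEnd (refl v * refl w)
      (by rw [map_mul, det_refl hv.ne', det_refl hw.ne']; norm_num)
      ((isLorentz_refl hv).mul (isLorentz_refl hw)).map_lorentz
    have hB : toEnd d B = refl v * refl w := toEnd_ofEnd _ _ _
    have h1 := mem_SOo_of_prod_refl hd l (B⁻¹ * A) (fun u hu => hl u (by simp [hu]))
      (by simpa [Nat.even_add_one] using he) (by
        rw [map_mul, h, List.map_cons, List.map_cons, List.prod_cons, List.prod_cons, ← mul_assoc,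
          ← mul_assoc, mul_assoc _ (refl v), ← hB, ← map_mul, inv_mul_cancel, map_one, one_mul])
    simpa using mul_mem (mem_SOo_of_toEnd_eq_refl_mul_refl hd hv hw hB) h1

theorem isLorentz_of_mem_SOo {A : SO d} (hA : A ∈ SOo d) : IsLorentz (toEnd d A) := by
  refine ⟨lorentz_toEnd A, ?_⟩
  by_contra! h
  have hc : Continuous fun B : SO d => toEnd d B (basePt d) (Fin.last d) :=
    (continuous_apply _).comp (continuous_toEnd_apply _)
  have h0 := (isPreconnected_connectedComponent (x := (1 : SO d))).intermediate_value hA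
    mem_connectedComponent hc.continuousOn
  obtain ⟨B, -, hB⟩ := h0 ⟨h, by simp⟩
  have h2 : lorentz (toEnd d B (basePt d)) (toEnd d B (basePt d)) = -1 := by
    rw [lorentz_toEnd]; simp
  refine last_ne_zero_of_lorentz_nonpos (by rw [h2]; norm_num) ?_ hB
  rintro h3
  simp [h3] at h2

/-- The identity component of `SO(d, 1)` consists of the orthochronous elements. -/
theorem mem_SOo_iff (hd : 2 ≤ d) {A : SO d} : A ∈ SOo d ↔ IsLorentz (toEnd d A) := by
  refine ⟨isLorentz_of_mem_SOo, fun h => ?_⟩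
  obtain ⟨l, hl, hA⟩ := h.exists_list_refl
  refine mem_SOo_of_prod_refl hd l A hl ?_ hA
  have := det_toEnd A
  rw [hA, det_prod_refl l hl] at this
  exact (neg_one_pow_eq_one_iff_even (by norm_num)).1 this

end IdentityComponent

/-! ### Isometries of the hyperboloid and linear maps -/

section Hyperboloid

variable {d : ℕ}

theorem Hyp.lorentz_eq (x y : Hyp d) : lorentz x.val y.val = -Real.cosh (dist x y) := by
  have : dist x y = Real.arcosh (-lorentz x.val y.val) := rfl
  rw [this, Real.cosh_arcosh (x.one_le_neg_lorentz y), neg_neg]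

/-- The base point of the hyperboloid. -/
def Hyp.base (d : ℕ) : Hyp d := ⟨basePt d, by simp, by simp⟩

/-- The point of the hyperboloid with coordinates `1` at `i`, `√2` at the last place and `0`
elsewhere. Together with the base point these points form a basis of `ℝ^(d+1)`. -/
noncomputable def Hyp.coordPt (i : Fin d) : Hyp d where
  val := Pi.single i.castSucc 1 + √2 • basePt d
  lorentz_self := by
    have : √2 * √2 = 2 := Real.mul_self_sqrt (by norm_num)
    simp [lorentz_add_right, lorentz_smul_right, lorentz_single_castSucc]
    linarith
  last_pos := by simp

theorem Hyp.coordPt_sub (i : Fin d) :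
    (Hyp.coordPt i).val - √2 • (Hyp.base d).val = Pi.single i.castSucc 1 :=
  add_sub_cancel_right _ _

theorem Hyp.continuous_val : Continuous (Hyp.val : Hyp d → Fin (d + 1) → ℝ) := by
  have h (y : Hyp d) : Continuous fun x : Hyp d => lorentz x.val y.val := by
    simp only [Hyp.lorentz_eq]; fun_prop
  refine continuous_pi fun j => Fin.lastCases ?_ (fun i => ?_) j
  · refine (h (Hyp.base d)).neg.congr fun x => ?_
    simp [Hyp.base]
  · refine ((h (Hyp.coordPt i)).sub ((continuous_const (y := √2)).mul (h (Hyp.base d)))).congr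
      fun x => ?_
    simp only [Pi.sub_apply, Pi.mul_apply, ← lorentz_smul_right, ← lorentz_sub_right,
      Hyp.coordPt_sub, lorentz_single_castSucc]

theorem Hyp.continuous_of_val {X : Type*} [TopologicalSpace X] {g : X → Hyp d}
    (hg : Continuous fun t => (g t).val) : Continuous g := by
  refine continuous_iff_continuousAt.2 fun t₀ => tendsto_iff_dist_tendsto_zero.2 ?_
  have hc : Continuous fun t => dist (g t) (g t₀) :=
    Real.continuousOn_arcosh.comp_continuous
      (continuous_lorentz.comp (hg.prodMk continuous_const)).neg
      fun t => (g t).one_le_neg_lorentz (g t₀)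
  simpa using hc.tendsto t₀

/-- The isometry of the hyperboloid given by a pair of mutually inverse Lorentz transformations. -/
noncomputable def IsLorentz.isometryEquiv {f g : Module.End ℝ (Fin (d + 1) → ℝ)}
    (hf : IsLorentz f) (hg : IsLorentz g) (hfg : f * g = 1) : Hyp d ≃ᵢ Hyp d :=
  IsometryEquiv.mk'
    (fun x => ⟨f x.val, by rw [hf.map_lorentz, x.lorentz_self],
      hf.last_pos (by rw [x.lorentz_self]; norm_num) x.last_pos⟩)
    (fun x => ⟨g x.val, by rw [hg.map_lorentz, x.lorentz_self],
      hg.last_pos (by rw [x.lorentz_self]; norm_num) x.last_pos⟩)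
    (fun x => Hyp.ext_val (congrArg (fun k : Module.End ℝ (Fin (d + 1) → ℝ) => k x.val) hfg))
    (Isometry.of_dist_eq fun x y => congrArg (fun r => Real.arcosh (-r)) (hf.map_lorentz _ _))

/-- The linear extension to `ℝ^(d+1)` of an isometry of the hyperboloid: the linear map that
agrees with it at the base point and at the points `Hyp.coordPt i`. -/
noncomputable def linExt (f : Hyp d ≃ᵢ Hyp d) : Module.End ℝ (Fin (d + 1) → ℝ) :=
  Fintype.linearCombination ℝ (Fin.snoc
    (fun i => (f (Hyp.coordPt i)).val - √2 • (f (Hyp.base d)).val) (f (Hyp.base d)).val :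
      Fin (d + 1) → Fin (d + 1) → ℝ)

theorem linExt_basePt (f : Hyp d ≃ᵢ Hyp d) : linExt f (basePt d) = (f (Hyp.base d)).val := by
  rw [linExt, basePt, Fintype.linearCombination_apply_single, one_smul, Fin.snoc_last]

theorem linExt_single (f : Hyp d ≃ᵢ Hyp d) (i : Fin d) :
    linExt f (Pi.single i.castSucc 1) =
      (f (Hyp.coordPt i)).val - √2 • (f (Hyp.base d)).val := by
  rw [linExt, Fintype.linearCombination_apply_single, one_smul, Fin.snoc_castSucc]

theorem lorentz_apply_apply (f : Hyp d ≃ᵢ Hyp d) (x y : Hyp d) :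
    lorentz (f x).val (f y).val = lorentz x.val y.val := by
  rw [Hyp.lorentz_eq, Hyp.lorentz_eq, f.dist_eq]

theorem lorentz_linExt_apply (f : Hyp d ≃ᵢ Hyp d) (q : Hyp d) (x : Fin (d + 1) → ℝ) :
    lorentz (linExt f x) (f q).val = lorentz x q.val := by
  have : (lorentzForm d).flip (f q).val ∘ₗ linExt f = (lorentzForm d).flip q.val := by
    refine LinearMap.pi_ext' fun j => LinearMap.ext_ring ?_
    refine Fin.lastCases ?_ (fun i => ?_) j
    · change lorentz (linExt f (basePt d)) (f q).val = lorentz (basePt d) q.val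
      rw [linExt_basePt, lorentz_apply_apply]; rfl
    · change lorentz (linExt f (Pi.single i.castSucc 1)) (f q).val =
        lorentz (Pi.single i.castSucc 1) q.val
      rw [linExt_single, lorentz_sub_left, lorentz_smul_left, lorentz_apply_apply,
        lorentz_apply_apply, ← lorentz_smul_left, ← lorentz_sub_left, Hyp.coordPt_sub]
  exact LinearMap.congr_fun this x

theorem lorentz_linExt_linExt (f : Hyp d ≃ᵢ Hyp d) (x y : Fin (d + 1) → ℝ) :
    lorentz (linExt f x) (linExt f y) = lorentz x y := by
  have : lorentzForm d (linExt f x) ∘ₗ linExt f = lorentzForm d x := by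
    refine LinearMap.pi_ext' fun j => LinearMap.ext_ring ?_
    refine Fin.lastCases ?_ (fun i => ?_) j
    · change lorentz (linExt f x) (linExt f (basePt d)) = lorentz x (basePt d)
      rw [linExt_basePt, lorentz_linExt_apply]; rfl
    · change lorentz (linExt f x) (linExt f (Pi.single i.castSucc 1)) =
        lorentz x (Pi.single i.castSucc 1)
      rw [linExt_single, lorentz_sub_right, lorentz_smul_right, lorentz_linExt_apply,
        lorentz_linExt_apply, ← lorentz_smul_right, ← lorentz_sub_right, Hyp.coordPt_sub]
  exact LinearMap.congr_fun this y

theorem isLorentz_linExt (f : Hyp d ≃ᵢ Hyp d) : IsLorentz (linExt f) :=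
  ⟨lorentz_linExt_linExt f, by rw [linExt_basePt]; exact Hyp.last_pos _⟩

/-- An isometry of the hyperboloid is the restriction of its linear extension. -/
theorem linExt_apply (f : Hyp d ≃ᵢ Hyp d) (q : Hyp d) : linExt f q.val = (f q).val := by
  refine (sub_eq_zero.1 (eq_zero_of_lorentz_eq_zero fun y => ?_))
  obtain ⟨x, rfl⟩ := (isLorentz_linExt f).surjective y
  rw [lorentz_comm, lorentz_sub_right, lorentz_linExt_linExt, lorentz_linExt_apply, sub_self]

/-- A linear map is determined by its values on the hyperboloid. -/
theorem end_ext_hyp {f g : Module.End ℝ (Fin (d + 1) → ℝ)} (h : ∀ x : Hyp d, f x.val = g x.val) :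
    f = g := by
  refine LinearMap.pi_ext' fun j => LinearMap.ext_ring ?_
  refine Fin.lastCases ?_ (fun i => ?_) j
  · exact h (Hyp.base d)
  · change f (Pi.single i.castSucc 1) = g (Pi.single i.castSucc 1)
    rw [← Hyp.coordPt_sub, map_sub, map_sub, map_smul, map_smul, h, h]

theorem IsLorentz.det_eq {f : Module.End ℝ (Fin (d + 1) → ℝ)} (hf : IsLorentz f) :
    LinearMap.det f = 1 ∨ LinearMap.det f = -1 := by
  obtain ⟨l, hl, rfl⟩ := hf.exists_list_refl
  rw [det_prod_refl l hl]
  exact neg_one_pow_eq_or ℝ _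

end Hyperboloid

section Isomorphism

/-- The action of `SO_o(d, 1)` on the hyperboloid. -/
noncomputable def actHom (d : ℕ) : SOo d →* (Hyp d ≃ᵢ Hyp d) where
  toFun A := (isLorentz_of_mem_SOo A.2).isometryEquiv (isLorentz_of_mem_SOo (A⁻¹).2)
    (by rw [← map_mul, ← Subgroup.coe_mul, mul_inv_cancel]; simp)
  map_one' := by
    ext1 x
    exact Hyp.ext_val (by
      change toEnd d ((1 : SOo d) : SO d) x.val = x.val
      simp)
  map_mul' A B := by
    ext1 x
    exact Hyp.ext_val (by
      change toEnd d ((A * B : SOo d) : SO d) x.val = toEnd d A (toEnd d B x.val)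
      simp)

theorem actHom_apply {d : ℕ} (A : SOo d) (x : Hyp d) :
    (actHom d A x).val = toEnd d (A : SO d) x.val := rfl

theorem continuous_moebius_apply {n : ℕ} (x : Hyp (n + 1)) :
    Continuous fun f : Moebius n => f x :=
  (continuous_apply x).comp continuous_induced_dom

theorem continuous_actHom (n : ℕ) : Continuous (fun A => actHom (n + 1) A : _ → Moebius n) := by
  refine continuous_induced_rng.2 (continuous_pi fun x => Hyp.continuous_of_val ?_)
  exact (continuous_toEnd_apply x.val).comp continuous_subtype_val

theorem actHom_mem (n : ℕ) (A : SOo (n + 1)) : actHom (n + 1) A ∈ MoebiusO n := by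
  have : PreconnectedSpace (SOo (n + 1)) :=
    isPreconnected_iff_preconnectedSpace.1
      (isPreconnected_connectedComponent (x := (1 : SO (n + 1))))
  exact (isPreconnected_range (continuous_actHom n)).subset_connectedComponent
    ⟨1, map_one _⟩ ⟨A, rfl⟩

theorem continuous_linExt_apply {n : ℕ} (x : Fin (n + 1 + 1) → ℝ) :
    Continuous fun f : Moebius n => linExt f x := by
  have h (y : Hyp (n + 1)) : Continuous fun f : Moebius n => (f y).val :=
    Hyp.continuous_val.comp (continuous_moebius_apply y)
  simp only [linExt, Fintype.linearCombination_apply]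
  refine continuous_finsetSum _ fun j _ => Continuous.const_smul ?_ (x j)
  refine Fin.lastCases ?_ (fun i => ?_) j
  · simpa only [Fin.snoc_last] using h _
  · simp only [Fin.snoc_castSucc]
    exact (h _).sub ((h _).const_smul √2)

theorem continuous_det_linExt (n : ℕ) :
    Continuous fun f : Moebius n => LinearMap.det (linExt f) := by
  simp only [← LinearMap.det_toMatrix']
  refine Continuous.matrix_det (continuous_matrix fun i j => ?_)
  refine ((continuous_apply i).comp (continuous_linExt_apply (Pi.single j 1))).congr fun f => ?_
  rw [LinearMap.toMatrix'_apply]; rfl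

theorem det_linExt {n : ℕ} {f : Moebius n} (hf : f ∈ MoebiusO n) :
    LinearMap.det (linExt f) = 1 := by
  refine (isLorentz_linExt f).det_eq.resolve_right fun h => ?_
  have h1 : linExt (1 : Moebius n) = 1 := end_ext_hyp fun x => linExt_apply _ x
  have h0 := (isPreconnected_connectedComponent (x := (1 : Moebius n))).intermediate_value hf
    mem_connectedComponent (continuous_det_linExt n).continuousOn
  obtain ⟨g, -, hg⟩ := h0 (show (0 : ℝ) ∈ _ from ⟨by simp [h], by simp [h1]⟩)
  rcases (isLorentz_linExt g).det_eq with h2 | h2 <;> simp_all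

/-- The element of `SO(n+1, 1)` that extends an element of `M_o(n)`. -/
noncomputable def moebiusToSO (n : ℕ) (f : MoebiusO n) : SO (n + 1) :=
  ofEnd (linExt f.1) (det_linExt f.2) (isLorentz_linExt f.1).map_lorentz

theorem toEnd_moebiusToSO {n : ℕ} (f : MoebiusO n) :
    toEnd (n + 1) (moebiusToSO n f) = linExt f.1 := toEnd_ofEnd _ _ _

theorem moebiusToSO_mem {n : ℕ} (f : MoebiusO n) : moebiusToSO n f ∈ SOo (n + 1) := by
  have : PreconnectedSpace (MoebiusO n) :=
    isPreconnected_iff_preconnectedSpace.1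
      (isPreconnected_connectedComponent (x := (1 : Moebius n)))
  have hc : Continuous (moebiusToSO n) := continuous_SO fun x => by
    simp only [toEnd_moebiusToSO]
    exact (continuous_linExt_apply x).comp continuous_subtype_val
  refine (isPreconnected_range hc).subset_connectedComponent ⟨1, toEnd_injective ?_⟩ ⟨f, rfl⟩
  rw [toEnd_moebiusToSO, map_one]
  exact end_ext_hyp fun x => linExt_apply _ x

/-- Restriction to the hyperboloid is an isomorphism of `SO_o(n+1, 1)` onto `M_o(n)`. -/
noncomputable def equivMoebiusO (n : ℕ) : SOo (n + 1) ≃* MoebiusO n :=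
  MulEquiv.ofBijective ((actHom (n + 1)).codRestrict (MoebiusO n) (actHom_mem n)) <| by
    constructor
    · intro A B h
      refine Subtype.ext (toEnd_injective (end_ext_hyp fun x => ?_))
      have := congrArg (fun f : MoebiusO n => ((f : Moebius n) x).val) h
      simpa [actHom_apply] using this
    · intro f
      refine ⟨⟨moebiusToSO n f, moebiusToSO_mem f⟩, Subtype.ext (IsometryEquiv.ext fun x => ?_)⟩
      refine Hyp.ext_val ?_
      rw [MonoidHom.codRestrict_apply, actHom_apply, toEnd_moebiusToSO, linExt_apply]

theorem equivMoebiusO_apply {n : ℕ} (A : SOo (n + 1)) (x : Hyp (n + 1)) :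
    ((equivMoebiusO n A : Moebius n) x).val = toEnd (n + 1) (A : SO (n + 1)) x.val := rfl

end Isomorphism

/-! ### Extremal vectors: eigenvectors of `f + f⁻¹` -/

section Pencil

/-- Let `q₁` and `q₂ ≥ 0` be quadratic on a closed cone, with `q₁` bounded below by a multiple of
`q₂`. For the largest `τ` with `τ q₂ ≤ q₁` on the cone, equality holds at a nonzero point:
otherwise `q₁ - τ q₂` is bounded below on the unit sphere of the cone, and `τ` can be increased. -/
theorem exists_extremal_pencil {E : Type*} [NormedAddCommGroup E] [NormedSpace ℝ E]
    [FiniteDimensional ℝ E] {X : Set E} (hX : IsClosed X) (hX' : ∀ (c : ℝ), ∀ x ∈ X, c • x ∈ X)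
    {q₁ q₂ : E → ℝ} (h₁ : Continuous q₁) (h₂ : Continuous q₂)
    (h₁' : ∀ (c : ℝ) x, q₁ (c • x) = c ^ 2 * q₁ x) (h₂' : ∀ (c : ℝ) x, q₂ (c • x) = c ^ 2 * q₂ x)
    (hnn : ∀ x ∈ X, 0 ≤ q₂ x) (hpos : ∃ x ∈ X, 0 < q₂ x) {c : ℝ}
    (hc : ∀ x ∈ X, c * q₂ x ≤ q₁ x) :
    ∃ τ : ℝ, (∀ x ∈ X, τ * q₂ x ≤ q₁ x) ∧ ∃ x ∈ X, x ≠ 0 ∧ q₁ x = τ * q₂ x := by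
  obtain ⟨p, hpX, hp⟩ := hpos
  set T : Set ℝ := {τ | ∀ x ∈ X, τ * q₂ x ≤ q₁ x} with hT
  have hb : BddAbove T := ⟨q₁ p / q₂ p, fun τ hτ => (le_div_iff₀ hp).2 (hτ p hpX)⟩
  have hmem : sSup T ∈ T := fun x hx => by
    rcases (hnn x hx).eq_or_lt with h0 | h0
    · have := hc x hx
      rw [← h0] at this ⊢
      simpa using this
    · rw [← le_div_iff₀ h0]
      exact csSup_le ⟨c, hc⟩ fun τ hτ => (le_div_iff₀ h0).2 (hτ x hx)
  refine ⟨sSup T, hmem, ?_⟩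
  by_contra! hne
  have hp0 : p ≠ 0 := by
    rintro rfl
    have := h₂' 0 0
    simp at this
    linarith
  have hKc : IsCompact (X ∩ Metric.sphere 0 1) := (isCompact_sphere 0 1).inter_left hX
  have hKn : (X ∩ Metric.sphere 0 1).Nonempty :=
    ⟨‖p‖⁻¹ • p, hX' _ _ hpX, by simp [norm_smul, norm_ne_zero_iff.2 hp0]⟩
  obtain ⟨a, ⟨haX, haS⟩, ha⟩ := hKc.exists_isMinOn hKn
    (h₁.sub (continuous_const.mul h₂) : Continuous fun x => q₁ x - sSup T * q₂ x).continuousOn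
  obtain ⟨b, ⟨hbX, -⟩, hbm⟩ := hKc.exists_isMaxOn hKn h₂.continuousOn
  have ha0 : a ≠ 0 := by
    rintro rfl
    simp at haS
  have hε : 0 < q₁ a - sSup T * q₂ a := by
    have h3 := hmem a haX
    have h4 := hne a haX ha0
    exact sub_pos.2 (h3.lt_of_ne' h4)
  set ε := q₁ a - sSup T * q₂ a with hεd
  have hM : 0 < q₂ b + 1 := by linarith [hnn b hbX]
  have hδ : 0 < ε / (q₂ b + 1) := by positivity
  have key : sSup T + ε / (q₂ b + 1) ∈ T := fun x hx => by
    rcases eq_or_ne x 0 with rfl | hx0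
    · have e1 := h₁' 0 0
      have e2 := h₂' 0 0
      simp at e1 e2
      simp [e1, e2]
    · have hn : ‖x‖ ≠ 0 := norm_ne_zero_iff.2 hx0
      set y := ‖x‖⁻¹ • x with hy
      have hyK : y ∈ X ∩ Metric.sphere 0 1 := ⟨hX' _ _ hx, by simp [hy, norm_smul, hn]⟩
      have hxy : x = ‖x‖ • y := by rw [hy, smul_smul, mul_inv_cancel₀ hn, one_smul]
      have h3 : ε ≤ q₁ y - sSup T * q₂ y := ha hyK
      have h4 : q₂ y ≤ q₂ b := hbm hyK
      have h5 : ε / (q₂ b + 1) * q₂ y ≤ ε := by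
        rw [div_mul_eq_mul_div, div_le_iff₀ hM]
        exact mul_le_mul_of_nonneg_left (by linarith) hε.le
      rw [hxy, h₁', h₂']
      have : 0 ≤ ‖x‖ ^ 2 := sq_nonneg _
      nlinarith
  linarith [le_csSup hb key]

theorem eq_zero_of_eventually_nonneg {a b : ℝ}
    (h : ∀ᶠ t in nhds (0 : ℝ), 0 ≤ t * a + t ^ 2 * b) : a = 0 := by
  have hm : IsLocalMin (fun t : ℝ => t * a + t ^ 2 * b) 0 := by
    filter_upwards [h] with t ht
    simpa using ht
  have hd : HasDerivAt (fun t : ℝ => t * a + t ^ 2 * b) (1 * a + (2 * (0 : ℝ) ^ 1 * 1) * b) 0 :=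
    ((hasDerivAt_id' (0 : ℝ)).mul_const a).add
      ((((hasDerivAt_id' (0 : ℝ)).pow 2).mul_const b).congr_deriv (by simp))
  simpa using hm.hasDerivAt_eq_zero hd

end Pencil

section Critical

variable {d : ℕ} {f : Module.End ℝ (Fin (d + 1) → ℝ)}

/-- The Euler–Lagrange equation at an extremal point `v` of the pencil spanned by the forms
`lorentz (f x) x` and `lorentz x x`; it says that `v` is an eigenvector of `f + f⁻¹`. -/
theorem lorentz_eq_zero_of_extremal (hf : IsLorentz f) {X : Set (Fin (d + 1) → ℝ)} {s τ : ℝ}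
    (hs : s ≠ 0) (hX : ∀ x ∈ X, 0 ≤ s * (lorentz (f x) x - τ * lorentz x x))
    {v y : Fin (d + 1) → ℝ} (hv : lorentz (f v) v = τ * lorentz v v)
    (hy : ∀ᶠ t in nhds (0 : ℝ), v + t • y ∈ X) :
    lorentz (f (f v) + v - (2 * τ) • f v) (f y) = 0 := by
  have h := eq_zero_of_eventually_nonneg
    (a := s * (lorentz (f v) y + lorentz (f y) v - 2 * τ * lorentz v y))
    (b := s * (lorentz (f y) y - τ * lorentz y y)) <| by
    filter_upwards [hy] with t ht
    have := hX _ ht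
    simp only [map_add, map_smul, lorentz_add_left, lorentz_add_right, lorentz_smul_left,
      lorentz_smul_right, lorentz_comm y v, hv] at this
    linarith
  have h2 := (mul_eq_zero.1 h).resolve_left hs
  rw [lorentz_sub_left, lorentz_add_left, lorentz_smul_left, hf.map_lorentz, hf.map_lorentz,
    lorentz_comm v (f y)]
  linarith

/-- On a positive definite invariant subspace there is an eigenvector of `f + f⁻¹`. -/
theorem IsLorentz.exists_eigenvector_of_posDef (hf : IsLorentz f)
    {W : Submodule ℝ (Fin (d + 1) → ℝ)} (hW : ∀ x ∈ W, x ≠ 0 → 0 < lorentz x x)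
    (hfW : ∀ x ∈ W, f x ∈ W) (hne : W ≠ ⊥) :
    ∃ v ∈ W, v ≠ 0 ∧ ∃ c : ℝ, f (f v) = c • f v - v := by
  have hcf : Continuous f := f.continuous_of_finiteDimensional
  have hnn : ∀ x ∈ W, 0 ≤ lorentz x x := fun x hx => by
    rcases eq_or_ne x 0 with rfl | h
    · simp
    · exact (hW x hx h).le
  obtain ⟨p, hpW, hp⟩ := W.ne_bot_iff.1 hne
  obtain ⟨τ, hτ, v, hvW, hv0, hv⟩ := exists_extremal_pencil (X := (W : Set (Fin (d + 1) → ℝ)))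
    W.closed_of_finiteDimensional (fun c x hx => W.smul_mem c hx)
    (q₁ := fun x => lorentz (f x) x) (q₂ := fun x => lorentz x x) (c := -1)
    (continuous_lorentz.comp (hcf.prodMk continuous_id))
    (continuous_lorentz.comp (continuous_id.prodMk continuous_id))
    (fun c x => by simp only [map_smul, lorentz_smul_left, lorentz_smul_right]; ring)
    (fun c x => by simp only [lorentz_smul_left, lorentz_smul_right]; ring)
    hnn ⟨p, hpW, hW p hpW hp⟩ fun x hx => by
      have := hnn _ (W.add_mem (hfW x hx) hx)
      simp only [lorentz_add_left, lorentz_add_right, hf.map_lorentz, lorentz_comm x (f x)] at this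
      linarith
  have hz : f (f v) + v - (2 * τ) • f v ∈ W :=
    W.sub_mem (W.add_mem (hfW _ (hfW _ hvW)) hvW) (W.smul_mem _ (hfW _ hvW))
  refine ⟨v, hvW, hv0, 2 * τ, ?_⟩
  by_contra hne
  have hz0 : f (f v) + v - (2 * τ) • f v ≠ 0 := fun h0 => hne (by
    rw [sub_eq_zero] at h0
    rw [← h0, add_sub_cancel_right])
  obtain ⟨y, hyW, hy⟩ := hf.map_surjOn hfW _ hz
  have h := lorentz_eq_zero_of_extremal hf (X := W) (s := 1) one_ne_zero
    (fun x hx => by linarith [hτ x hx]) hv (y := y)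
    (Filter.Eventually.of_forall fun t => W.add_mem hvW (W.smul_mem t hyW))
  rw [hy] at h
  exact (hW _ hz hz0).ne' h

/-- A Lorentz transformation has a timelike vector that is an eigenvector of `f + f⁻¹`, or a null
eigenvector. The infimum of `-lorentz (f x) x` over the hyperboloid is attained in the first
case, and approached at infinity in the second. -/
theorem IsLorentz.exists_timelike_or_null (hf : IsLorentz f) :
    (∃ v, lorentz v v < 0 ∧ ∃ c : ℝ, f (f v) = c • f v - v) ∨
      ∃ u, u ≠ 0 ∧ lorentz u u = 0 ∧ ∃ c : ℝ, f u = c • u := by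
  have hcf : Continuous f := f.continuous_of_finiteDimensional
  have hc2 : Continuous fun x : Fin (d + 1) → ℝ => lorentz x x :=
    continuous_lorentz.comp (continuous_id.prodMk continuous_id)
  obtain ⟨τ, hτ, v, hvX, hv0, hv⟩ := exists_extremal_pencil
    (X := {x : Fin (d + 1) → ℝ | lorentz x x ≤ 0})
    (isClosed_le hc2 continuous_const) (fun c x (hx : lorentz x x ≤ 0) => by
      change lorentz _ _ ≤ 0
      rw [lorentz_smul_left, lorentz_smul_right, ← mul_assoc]
      exact mul_nonpos_of_nonneg_of_nonpos (mul_self_nonneg c) hx)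
    (q₁ := fun x => -lorentz (f x) x) (q₂ := fun x => -lorentz x x) (c := 0)
    (continuous_lorentz.comp (hcf.prodMk continuous_id)).neg hc2.neg
    (fun c x => by simp only [map_smul, lorentz_smul_left, lorentz_smul_right]; ring)
    (fun c x => by simp only [lorentz_smul_left, lorentz_smul_right]; ring)
    (fun x (hx : lorentz x x ≤ 0) => by linarith) ⟨basePt d, by simp, by simp⟩
    fun x hx => by
      have := hf.lorentz_apply_nonpos hx
      linarith
  rcases (show lorentz v v ≤ 0 from hvX).lt_or_eq with hneg | h0
  · left
    refine ⟨v, hneg, 2 * τ, ?_⟩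
    have h : f (f v) + v - (2 * τ) • f v = 0 := eq_zero_of_lorentz_eq_zero fun w => by
      obtain ⟨y, rfl⟩ := hf.surjective w
      refine lorentz_eq_zero_of_extremal hf (X := {x | lorentz x x ≤ 0}) (s := -1) (by norm_num)
        (fun x hx => by linarith [hτ x hx]) (by linarith [hv]) ?_
      have hct : Continuous fun t : ℝ => lorentz (v + t • y) (v + t • y) :=
        hc2.comp (by fun_prop)
      have := hct.tendsto 0
      simp only [zero_smul, add_zero] at this
      filter_upwards [this.eventually_lt_const hneg] with t ht using ht.le
    rw [sub_eq_zero] at h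
    rw [← h, add_sub_cancel_right]
  · right
    refine ⟨v, hv0, h0, eq_smul_of_null h0 hv0 ?_ ?_⟩
    · rw [h0] at hv
      linarith
    · rw [hf.map_lorentz, h0]

end Critical

/-! ### Every Lorentz transformation is conjugate to its inverse -/

section Orthogonal

variable {d : ℕ} {f : Module.End ℝ (Fin (d + 1) → ℝ)} {W W₁ W₂ : Submodule ℝ (Fin (d + 1) → ℝ)}

/-- The orthogonal complement for the Lorentz form. -/
abbrev perp (W : Submodule ℝ (Fin (d + 1) → ℝ)) : Submodule ℝ (Fin (d + 1) → ℝ) :=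
  (lorentzForm d).orthogonal W

theorem mem_perp {x : Fin (d + 1) → ℝ} : x ∈ perp W ↔ ∀ y ∈ W, lorentz x y = 0 := by
  simp only [LinearMap.BilinForm.mem_orthogonal_iff, lorentzForm_apply, lorentz_comm x]

theorem IsLorentz.map_perp (hf : IsLorentz f) (hfW : ∀ x ∈ W, f x ∈ W) :
    ∀ x ∈ perp W, f x ∈ perp W := fun x hx => mem_perp.2 fun y hy => by
  obtain ⟨z, hz, rfl⟩ := hf.map_surjOn hfW y hy
  rw [hf.map_lorentz, mem_perp.1 hx z hz]

theorem sup_inf_perp (h : W₁ ≤ W) (hd : Disjoint W₁ (perp W₁)) : W₁ ⊔ (W ⊓ perp W₁) = W := by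
  have hc := ((lorentzForm d).isCompl_orthogonal_iff_disjoint (lorentzForm_isRefl d)).2 hd
  rw [inf_comm, ← sup_inf_assoc_of_le _ h, hc.sup_eq_top, top_inf_eq]

theorem finrank_add_finrank_inf_perp (h : W₁ ≤ W) (hd : Disjoint W₁ (perp W₁)) :
    Module.finrank ℝ W₁ + Module.finrank ℝ (W ⊓ perp W₁ : Submodule ℝ _) =
      Module.finrank ℝ W := by
  have := Submodule.finrank_sup_add_finrank_inf_eq W₁ (W ⊓ perp W₁)
  rw [sup_inf_perp h hd, (hd.mono_right inf_le_right).eq_bot, finrank_bot] at this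
  omega

theorem disjoint_perp_of_posDef (h : ∀ x ∈ W, x ≠ 0 → 0 < lorentz x x) : Disjoint W (perp W) := by
  rw [Submodule.disjoint_def]
  intro x hx hx'
  by_contra h0
  exact (h x hx h0).ne' (mem_perp.1 hx' x hx)

theorem disjoint_perp_of_timelike {t : Fin (d + 1) → ℝ} (ht : t ∈ W) (htt : lorentz t t < 0) :
    Disjoint W (perp W) := by
  rw [Submodule.disjoint_def]
  intro x hx hx'
  by_contra h0
  exact (lorentz_pos_of_orthogonal htt (mem_perp.1 hx' t ht) h0).ne' (mem_perp.1 hx' x hx)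

end Orthogonal

section Reverser

variable {d : ℕ} {f h h₁ h₂ : Module.End ℝ (Fin (d + 1) → ℝ)}
  {W W₁ W₂ : Submodule ℝ (Fin (d + 1) → ℝ)}

/-- A reverser of `f` on a subspace `W` is a Lorentz transformation that is the identity on the
orthogonal complement of `W`, maps `W` to itself, and conjugates `f` to its inverse on `W`. The
last condition is written as `f h f = h` to avoid the inverse. -/
structure IsReverser (f : Module.End ℝ (Fin (d + 1) → ℝ)) (W : Submodule ℝ (Fin (d + 1) → ℝ))
    (h : Module.End ℝ (Fin (d + 1) → ℝ)) : Prop where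
  isLorentz : IsLorentz h
  mapsTo : ∀ x ∈ W, h x ∈ W
  fixes : ∀ x ∈ perp W, h x = x
  rev : ∀ x ∈ W, f (h (f x)) = h x

/-- Reversers on orthogonal invariant subspaces can be multiplied. -/
theorem IsReverser.mul (hr₁ : IsReverser f W₁ h₁) (hr₂ : IsReverser f W₂ h₂)
    (hf₁ : ∀ x ∈ W₁, f x ∈ W₁) (hf₂ : ∀ x ∈ W₂, f x ∈ W₂) (hW : W₁ ≤ perp W₂) :
    IsReverser f (W₁ ⊔ W₂) (h₁ * h₂) := by
  have hW' : W₂ ≤ perp W₁ := fun x hx => mem_perp.2 fun y hy => by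
    rw [lorentz_comm]; exact mem_perp.1 (hW hy) x hx
  refine ⟨hr₁.isLorentz.mul hr₂.isLorentz, fun x hx => ?_, fun x hx => ?_, fun x hx => ?_⟩
  · obtain ⟨a, ha, b, hb, rfl⟩ := Submodule.mem_sup.1 hx
    rw [Module.End.mul_apply, map_add, map_add, hr₂.fixes a (hW ha),
      hr₁.fixes _ (hW' (hr₂.mapsTo b hb))]
    exact Submodule.add_mem_sup (hr₁.mapsTo a ha) (hr₂.mapsTo b hb)
  · rw [Module.End.mul_apply,
      hr₂.fixes x (mem_perp.2 fun y hy => mem_perp.1 hx y (Submodule.mem_sup_right hy)),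
      hr₁.fixes x (mem_perp.2 fun y hy => mem_perp.1 hx y (Submodule.mem_sup_left hy))]
  · obtain ⟨a, ha, b, hb, rfl⟩ := Submodule.mem_sup.1 hx
    simp only [Module.End.mul_apply, map_add]
    rw [hr₂.fixes a (hW ha), hr₂.fixes _ (hW (hf₁ a ha)), hr₁.rev a ha,
      hr₁.fixes _ (hW' (hr₂.mapsTo b hb)), hr₁.fixes _ (hW' (hr₂.mapsTo _ (hf₂ b hb))),
      hr₂.rev b hb]

theorem isReverser_one (h : ∀ x ∈ W, f (f x) = x) : IsReverser f W 1 :=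
  ⟨IsLorentz.one, fun _ hx => hx, fun _ _ => rfl, h⟩

theorem isReverser_refl {s : Set (Fin (d + 1) → ℝ)} {e : Fin (d + 1) → ℝ}
    (he : e ∈ Submodule.span ℝ s) (hpos : 0 < lorentz e e)
    (h : ∀ x ∈ s, f (refl e (f x)) = refl e x) : IsReverser f (Submodule.span ℝ s) (refl e) where
  isLorentz := isLorentz_refl hpos
  mapsTo x hx := by
    rw [refl_apply]
    exact Submodule.sub_mem _ hx (Submodule.smul_mem _ _ he)
  fixes x hx := refl_apply_of_orthogonal (mem_perp.1 hx e he)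
  rev x hx := LinearMap.eqOn_span (f := f * refl e * f) (g := refl e) h hx

theorem forall_mem_span_apply_mem {s : Set (Fin (d + 1) → ℝ)}
    (h : ∀ x ∈ s, f x ∈ Submodule.span ℝ s) :
    ∀ x ∈ Submodule.span ℝ s, f x ∈ Submodule.span ℝ s :=
  fun _ hx => (Submodule.span_le (p := (Submodule.span ℝ s).comap f)).2 h hx

variable {v : Fin (d + 1) → ℝ} {c : ℝ}

theorem forall_mem_span_pair (hv : f (f v) = c • f v - v) :
    ∀ x ∈ Submodule.span ℝ {v, f v}, f x ∈ Submodule.span ℝ {v, f v} := by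
  refine forall_mem_span_apply_mem ?_
  rintro x (rfl | rfl)
  · exact Submodule.subset_span (by simp)
  · rw [hv]
    exact Submodule.sub_mem _ (Submodule.smul_mem _ _ (Submodule.subset_span (by simp)))
      (Submodule.subset_span (by simp))

/-- If `v` is an eigenvector of `f + f⁻¹`, then the reflection that swaps `v` and `f v` reverses `f`
on their span. -/
theorem isReverser_span_pair (hf : IsLorentz f) (hv : f (f v) = c • f v - v)
    (hpos : 0 < lorentz (f v - v) (f v - v)) :
    IsReverser f (Submodule.span ℝ {v, f v}) (refl (f v - v)) := by
  have h1 := refl_sub_apply (hf.map_lorentz v v).symm hpos.ne'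
  have h2 := refl_sub_apply' (hf.map_lorentz v v).symm hpos.ne'
  refine isReverser_refl (Submodule.sub_mem _ (Submodule.subset_span (by simp))
    (Submodule.subset_span (by simp))) hpos ?_
  rintro x (rfl | rfl)
  · rw [h2, h1]
  · rw [hv, map_sub, map_smul, h1, h2, map_sub, map_smul, hv, sub_sub_cancel]

theorem finrank_span_pair {v w : Fin (d + 1) → ℝ} (hv : v ≠ 0) (h : ∀ a : ℝ, w ≠ a • v) :
    Module.finrank ℝ (Submodule.span ℝ {v, w}) = 2 := by
  have : LinearIndependent ℝ ![v, w] := by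
    rw [LinearIndependent.pair_iff' hv]
    exact fun a ha => h a ha.symm
  have h2 := finrank_span_eq_card this
  rwa [Matrix.range_cons, Matrix.range_cons, Matrix.range_empty, Set.union_empty,
    Set.singleton_union, Fintype.card_fin] at h2

/-- A Lorentz transformation reverses on a positive definite invariant subspace `W`, by a reverser
of determinant `(-1) ^ m` where `m` is `finrank W / 2`, rounded up or down. Each invariant plane
without eigenvectors contributes a reflection; an eigenvector can be reflected or not. -/
theorem IsLorentz.exists_reverser_of_posDef (hf : IsLorentz f) (k : ℕ) :
    ∀ (W : Submodule ℝ (Fin (d + 1) → ℝ)), Module.finrank ℝ W = k →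
      (∀ x ∈ W, x ≠ 0 → 0 < lorentz x x) → (∀ x ∈ W, f x ∈ W) →
      ∀ m : ℕ, m = k / 2 ∨ m = (k + 1) / 2 →
        ∃ h, IsReverser f W h ∧ LinearMap.det h = (-1) ^ m := by
  induction k using Nat.strong_induction_on with
  | _ k ih =>
  intro W hk hW hfW m hm
  -- Splitting off an invariant subspace on which a reverser is known.
  have split : ∀ (W₁ : Submodule ℝ (Fin (d + 1) → ℝ)) (h₁ : Module.End ℝ (Fin (d + 1) → ℝ))
      (m' : ℕ), W₁ ≤ W → (∀ x ∈ W₁, f x ∈ W₁) → IsReverser f W₁ h₁ → Module.finrank ℝ W₁ ≠ 0 →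
      (m' = (k - Module.finrank ℝ W₁) / 2 ∨ m' = (k - Module.finrank ℝ W₁ + 1) / 2) →
      ∃ h, IsReverser f W h ∧ LinearMap.det h = LinearMap.det h₁ * (-1) ^ m' := by
    intro W₁ h₁ m' hle hf₁ hr₁ hne hm'
    have hdis := disjoint_perp_of_posDef fun x hx => hW x (hle hx)
    have hfr := finrank_add_finrank_inf_perp hle hdis
    have hf₂ : ∀ x ∈ W ⊓ perp W₁, f x ∈ W ⊓ perp W₁ := fun x hx =>
      ⟨hfW x hx.1, hf.map_perp hf₁ x hx.2⟩
    obtain ⟨h₂, hr₂, hdet⟩ := ih (k - Module.finrank ℝ W₁) (by omega) (W ⊓ perp W₁) (by omega)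
      (fun x hx => hW x hx.1) hf₂ m' hm'
    refine ⟨h₁ * h₂, ?_, by rw [map_mul, hdet]⟩
    rw [← sup_inf_perp hle hdis]
    refine hr₁.mul hr₂ hf₁ hf₂ fun x hx => mem_perp.2 fun y hy => ?_
    rw [lorentz_comm]
    exact mem_perp.1 hy.2 x hx
  rcases Nat.eq_zero_or_pos k with rfl | hkpos
  · have hbot : W = ⊥ := Submodule.finrank_eq_zero.1 hk
    subst hbot
    refine ⟨1, isReverser_one fun x hx => ?_, ?_⟩
    · rw [(Submodule.mem_bot ℝ).1 hx, map_zero, map_zero]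
    · have : m = 0 := by omega
      simp [this]
  obtain ⟨v, hvW, hv0, c, hv⟩ := hf.exists_eigenvector_of_posDef hW hfW (by
    rintro rfl
    rw [finrank_bot] at hk
    omega)
  have hvpos := hW v hvW hv0
  by_cases hdep : ∃ a : ℝ, f v = a • v
  · obtain ⟨a, ha⟩ := hdep
    have haa : a * a = 1 := by
      have := hf.map_lorentz v v
      rw [ha, lorentz_smul_left, lorentz_smul_right, ← mul_assoc] at this
      exact mul_right_cancel₀ hvpos.ne' (this.trans (one_mul _).symm)
    have hle : Submodule.span ℝ {v} ≤ W := by simpa using hvW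
    have hfr : Module.finrank ℝ (Submodule.span ℝ {v}) = 1 := finrank_span_singleton hv0
    have hf₁ : ∀ x ∈ Submodule.span ℝ {v}, f x ∈ Submodule.span ℝ {v} :=
      forall_mem_span_apply_mem (by
        rintro x rfl
        rw [ha]
        exact Submodule.smul_mem _ _ (Submodule.mem_span_singleton_self _))
    have hr1 : IsReverser f (Submodule.span ℝ {v}) 1 := isReverser_one fun x hx => by
      obtain ⟨b, rfl⟩ := Submodule.mem_span_singleton.1 hx
      rw [map_smul, map_smul, ha, map_smul, ha, smul_smul a, haa, one_smul]
    have hr2 : IsReverser f (Submodule.span ℝ {v}) (refl v) :=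
      isReverser_refl (Submodule.mem_span_singleton_self _) hvpos (by
        rintro x rfl
        rw [ha, map_smul, refl_apply_self hvpos.ne', smul_neg, map_neg, map_smul, ha, smul_smul,
          haa, one_smul])
    -- The eigenvector is left alone or reflected, as the prescribed determinant requires.
    rcases Nat.even_or_odd (m + (k - 1) / 2) with hpar | hpar
    · obtain ⟨h, hr, hdet⟩ := split _ 1 ((k - 1) / 2) hle hf₁ hr1 (by omega) (by omega)
      refine ⟨h, hr, ?_⟩
      rw [hdet, map_one, one_mul]
      exact neg_one_pow_congr (by grind)
    · obtain ⟨h, hr, hdet⟩ := split _ (refl v) ((k - 1) / 2) hle hf₁ hr2 (by omega) (by omega)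
      refine ⟨h, hr, ?_⟩
      rw [hdet, det_refl hvpos.ne', ← pow_succ']
      exact neg_one_pow_congr (by grind)
  · push Not at hdep
    have hle : Submodule.span ℝ {v, f v} ≤ W := Submodule.span_le.2 (by
      rintro x (rfl | rfl)
      · exact hvW
      · exact hfW _ hvW)
    have hfr := finrank_span_pair hv0 hdep
    have hk2 : 2 ≤ k := by
      rw [← hk, ← hfr]
      exact Submodule.finrank_mono hle
    have hpos : 0 < lorentz (f v - v) (f v - v) :=
      hW _ (W.sub_mem (hfW v hvW) hvW) (sub_ne_zero.2 (by simpa using hdep 1))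
    obtain ⟨h, hr, hdet⟩ := split _ _ (m - 1) hle (forall_mem_span_pair hv)
      (isReverser_span_pair hf hv hpos) (by omega) (by omega)
    refine ⟨h, hr, ?_⟩
    rw [hdet, det_refl hpos.ne', ← pow_succ']
    congr 1
    omega

/-- A reverser on a subspace that contains a timelike vector extends to the whole space, because
the orthogonal complement is positive definite. -/
theorem IsLorentz.exists_reverser_of_core (hf : IsLorentz f) {C : Submodule ℝ (Fin (d + 1) → ℝ)}
    {t : Fin (d + 1) → ℝ} (ht : t ∈ C) (htt : lorentz t t < 0) (hfC : ∀ x ∈ C, f x ∈ C)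
    (hr₁ : IsReverser f C h₁) (m : ℕ) (hdet₁ : LinearMap.det h₁ = (-1) ^ m)
    (hm : Module.finrank ℝ C = 2 * m ∨ Module.finrank ℝ C = 2 * m + 1) :
    ∃ h, IsReverser f ⊤ h ∧ LinearMap.det h = (-1) ^ ((d + 1) / 2) := by
  have hdis := disjoint_perp_of_timelike ht htt
  have hfr := finrank_add_finrank_inf_perp (le_top : C ≤ ⊤) hdis
  have hsup := sup_inf_perp (le_top : C ≤ ⊤) hdis
  rw [top_inf_eq] at hfr hsup
  rw [finrank_top, Module.finrank_fin_fun] at hfr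
  have hf₂ := hf.map_perp hfC
  obtain ⟨h₂, hr₂, hdet⟩ := hf.exists_reverser_of_posDef _ (perp C) rfl
    (fun x hx hx0 => lorentz_pos_of_orthogonal htt (mem_perp.1 hx t ht) hx0) hf₂
    ((d + 1) / 2 - m) (by omega)
  refine ⟨h₁ * h₂, ?_, ?_⟩
  · rw [← hsup]
    refine hr₁.mul hr₂ hfC hf₂ fun x hx => mem_perp.2 fun y hy => ?_
    rw [lorentz_comm]
    exact mem_perp.1 hy x hx
  · rw [map_mul, hdet, hdet₁, ← pow_add]
    congr 1
    omega

theorem IsLorentz.exists_reverser_of_timelike (hf : IsLorentz f) (hvv : lorentz v v < 0)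
    (hv : f (f v) = c • f v - v) :
    ∃ h, IsReverser f ⊤ h ∧ LinearMap.det h = (-1) ^ ((d + 1) / 2) := by
  have hv0 : v ≠ 0 := by
    rintro rfl
    simp at hvv
  by_cases hfix : f v = v
  · refine hf.exists_reverser_of_core (Submodule.mem_span_singleton_self v) hvv ?_
      (isReverser_one fun x hx => ?_) 0 (by simp) (Or.inr (finrank_span_singleton hv0))
    · refine forall_mem_span_apply_mem ?_
      rintro x rfl
      rw [hfix]
      exact Submodule.mem_span_singleton_self _
    · obtain ⟨b, rfl⟩ := Submodule.mem_span_singleton.1 hx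
      rw [map_smul, map_smul, hfix, hfix]
  · have hpos := hf.displacement_pos_of_timelike hvv hfix
    refine hf.exists_reverser_of_core (Submodule.subset_span (by simp)) hvv
      (forall_mem_span_pair hv) (isReverser_span_pair hf hv hpos) 1
      (by rw [det_refl hpos.ne', pow_one]) (Or.inl (finrank_span_pair hv0 fun a ha => hfix ?_))
    -- a timelike eigenvector has eigenvalue `1`, as `f` preserves the sheets
    have haa : a * a = 1 := by
      have := hf.map_lorentz v v
      rw [ha, lorentz_smul_left, lorentz_smul_right, ← mul_assoc] at this
      exact mul_right_cancel₀ hvv.ne (this.trans (one_mul _).symm)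
    have hneg := hf.lorentz_apply_neg hvv
    rw [ha, lorentz_smul_left] at hneg
    have ha1 : a = 1 := by nlinarith
    rw [ha, ha1, one_smul]

theorem IsLorentz.lorentz_displacement_of_fixed (hf : IsLorentz f) {u : Fin (d + 1) → ℝ}
    (hfu : f u = u) (x : Fin (d + 1) → ℝ) : lorentz (f x - x) u = 0 := by
  have : lorentz (f x) u = lorentz x u := by
    conv_lhs => rw [← hfu]
    rw [hf.map_lorentz]
  rw [lorentz_sub_left, this, sub_self]

/-- If `f` fixes the null vector `u`, then `f - 1` induces on `uᗮ / u` an operator whose nilpotent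
vectors are in the kernel, because `f` induces an orthogonal transformation of this Euclidean space.
-/
theorem IsLorentz.sub_one_mem_span_of_pow (hf : IsLorentz f) {u : Fin (d + 1) → ℝ} (hu0 : u ≠ 0)
    (hu : lorentz u u = 0) (hfu : f u = u) {x : Fin (d + 1) → ℝ} (hx : lorentz x u = 0) (k : ℕ)
    (hk : ∃ a : ℝ, ((f - 1) ^ (k + 1)) x = a • u) : ∃ a : ℝ, (f - 1) x = a • u := by
  induction k with
  | zero => simpa using hk
  | succ k ih =>
    apply ih
    obtain ⟨a, ha⟩ := hk
    have hperp : lorentz (((f - 1) ^ k) x) u = 0 := by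
      cases k with
      | zero => simpa using hx
      | succ k =>
        rw [pow_succ', Module.End.mul_apply]
        exact hf.lorentz_displacement_of_fixed hfu _
    rw [pow_succ', pow_succ', Module.End.mul_apply, Module.End.mul_apply] at ha
    rw [pow_succ', Module.End.mul_apply]
    set y := ((f - 1) ^ k) x
    set z := (f - 1) y with hz
    have hzu : lorentz z u = 0 := hf.lorentz_displacement_of_fixed hfu y
    have hfy : f y = y + z := by simp [hz]
    have hfz : f z = z + a • u := by rw [← ha]; simp
    have e1 := hf.map_lorentz y y
    have e2 := hf.map_lorentz y z
    rw [hfy] at e1 e2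
    rw [hfz] at e2
    simp only [lorentz_add_left, lorentz_add_right, lorentz_smul_right, hperp, hzu,
      lorentz_comm z y] at e1 e2
    exact eq_smul_of_null hu hu0 hzu (by linarith)

/-- A Lorentz transformation that fixes a null vector `u` has a timelike vector `z` in the
generalized eigenspace of `1`: the Fitting decomposition for `f - 1` is orthogonal, so this
eigenspace is not contained in `uᗮ`. -/
theorem IsLorentz.exists_timelike_unipotent (hf : IsLorentz f) {u : Fin (d + 1) → ℝ} (hu0 : u ≠ 0)
    (hu : lorentz u u = 0) (hfu : f u = u) :
    ∃ z, lorentz z z < 0 ∧ ∃ k : ℕ, ((f - 1) ^ k) z = 0 := by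
  have hg : (f - 1) u = 0 := by simp [hfu]
  have horth : ∀ y ∈ ⨅ k, LinearMap.range ((f - 1) ^ k), lorentz y u = 0 := fun y hy => by
    obtain ⟨w, rfl⟩ := (Submodule.mem_iInf _).1 hy 1
    rw [pow_one]
    exact hf.lorentz_displacement_of_fixed hfu w
  have hcompl := LinearMap.isCompl_iSup_ker_pow_iInf_range_pow (f - 1)
  have hex : ∃ z ∈ ⨆ k, LinearMap.ker ((f - 1) ^ k), lorentz z u ≠ 0 := by
    by_contra! hcon
    refine hu0 (eq_zero_of_lorentz_eq_zero fun x => ?_)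
    have hx : x ∈ (⨆ k, LinearMap.ker ((f - 1) ^ k)) ⊔ ⨅ k, LinearMap.range ((f - 1) ^ k) := by
      rw [hcompl.sup_eq_top]
      exact Submodule.mem_top
    obtain ⟨a, ha, b, hb, rfl⟩ := Submodule.mem_sup.1 hx
    rw [lorentz_comm, lorentz_add_left, hcon a ha, horth b hb, add_zero]
  obtain ⟨z, hz, hzu⟩ := hex
  have hmono : Monotone fun k => LinearMap.ker ((f - 1) ^ k) := fun i j hij x hx => by
    obtain ⟨m, rfl⟩ := Nat.exists_eq_add_of_le' hij
    rw [LinearMap.mem_ker] at hx ⊢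
    rw [pow_add, Module.End.mul_apply, hx, map_zero]
  obtain ⟨k, hk⟩ := (Submodule.mem_iSup_of_directed _ hmono.directed_le).1 hz
  set s := -(lorentz z z + 1) / (2 * lorentz z u) with hs
  refine ⟨z + s • u, ?_, k + 1, ?_⟩
  · have : s * (2 * lorentz z u) = -(lorentz z z + 1) := by
      rw [hs]; field_simp
    simp only [lorentz_add_left, lorentz_add_right, lorentz_smul_left, lorentz_smul_right, hu,
      lorentz_comm u z]
    linarith
  · rw [map_add, map_smul, pow_succ', Module.End.mul_apply, LinearMap.mem_ker.1 hk, map_zero,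
      ← pow_succ', pow_succ, Module.End.mul_apply, hg, map_zero, smul_zero, add_zero]

/-- The parabolic case. For a timelike vector `z` on which `f` is unipotent, put `y = f z - z`;
then `f y - y` is a multiple of `u`, and the reflection in `y` reverses `f` on the span of `z`, `y`
and `u`. -/
theorem IsLorentz.exists_reverser_of_fixed_null (hf : IsLorentz f) {u : Fin (d + 1) → ℝ}
    (hu0 : u ≠ 0) (hu : lorentz u u = 0) (hfu : f u = u) :
    ∃ h, IsReverser f ⊤ h ∧ LinearMap.det h = (-1) ^ ((d + 1) / 2) := by
  obtain ⟨z, hz, k, hk⟩ := hf.exists_timelike_unipotent hu0 hu hfu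
  set y := f z - z with hy
  have hfz : f z = z + y := by rw [hy]; abel
  have hyu : lorentz y u = 0 := hf.lorentz_displacement_of_fixed hfu z
  obtain ⟨a, ha⟩ := hf.sub_one_mem_span_of_pow hu0 hu hfu hyu k ⟨0, by
    have e : y = (f - 1) z := rfl
    rw [e, ← Module.End.mul_apply, ← pow_succ, pow_add, pow_one, pow_succ', mul_assoc,
      Module.End.mul_apply, pow_mul_comm', Module.End.mul_apply, hk, map_zero, map_zero, zero_smul]⟩
  have hfy : f y = y + a • u := by
    rw [← ha]; simp
  by_cases ha0 : a = 0
  · refine hf.exists_reverser_of_timelike hz (c := 2) ?_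
    rw [hfz, map_add, hfy, hfz, ha0]
    module
  have hypos : 0 < lorentz y y := by
    refine (lorentz_pos_or_eq_smul_of_orthogonal hu hu0 hyu).resolve_right ?_
    rintro ⟨b, hb⟩
    rw [hb, map_smul, hfu] at hfy
    have : a • u = 0 := by simpa using hfy
    exact (smul_ne_zero ha0 hu0) this
  have hzu : lorentz z u ≠ 0 := fun h0 => by
    have := lorentz_pos_of_orthogonal hz ((lorentz_comm u z).trans h0) hu0
    linarith
  have hyz1 := refl_sub_apply (hf.map_lorentz z z).symm hypos.ne'
  have hyz2 := refl_sub_apply' (hf.map_lorentz z z).symm hypos.ne'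
  rw [← hy] at hyz1 hyz2
  have hru : refl y u = u := refl_apply_of_orthogonal ((lorentz_comm u y).trans hyu)
  have hry : refl y y = -y := refl_apply_self hypos.ne'
  have hzm : z ∈ Submodule.span ℝ {z, y, u} := Submodule.subset_span (by simp)
  have hym : y ∈ Submodule.span ℝ {z, y, u} := Submodule.subset_span (by simp)
  have hum : u ∈ Submodule.span ℝ {z, y, u} := Submodule.subset_span (by simp)
  refine hf.exists_reverser_of_core hzm hz (forall_mem_span_apply_mem ?_)
    (isReverser_refl hym hypos ?_) 1 (by rw [det_refl hypos.ne', pow_one]) (Or.inr ?_)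
  · rintro x (rfl | rfl | rfl)
    · rw [hfz]
      exact Submodule.add_mem _ hzm hym
    · rw [hfy]
      exact Submodule.add_mem _ hym (Submodule.smul_mem _ _ hum)
    · rwa [hfu]
  · rintro x (rfl | rfl | rfl)
    · rw [hyz2, hyz1]
    · rw [hfy, map_add, map_smul, hru, hry, map_add, map_neg, map_smul, hfu, hfy]
      abel
    · rw [hfu, hru, hfu]
  · have hli : LinearIndependent ℝ ![z, y, u] := by
      rw [Fintype.linearIndependent_iff]
      intro g hg
      simp only [Fin.sum_univ_three, Matrix.cons_val] at hg
      have e1 := congrArg (fun x => lorentz x u) hg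
      simp only [lorentz_add_left, lorentz_smul_left, hyu, hu, lorentz_zero_left, mul_zero,
        add_zero, mul_eq_zero, hzu, or_false] at e1
      rw [e1, zero_smul, zero_add] at hg
      have e2 := congrArg (fun x => lorentz x y) hg
      simp only [lorentz_add_left, lorentz_smul_left, lorentz_comm u y, hyu, lorentz_zero_left,
        mul_zero, add_zero, mul_eq_zero, hypos.ne', or_false] at e2
      rw [e2, zero_smul, zero_add, smul_eq_zero] at hg
      intro i
      fin_cases i
      · exact e1
      · exact e2
      · exact hg.resolve_right hu0
    have h2 := finrank_span_eq_card hli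
    rwa [Matrix.range_cons, Matrix.range_cons, Matrix.range_cons, Matrix.range_empty,
      Set.union_empty, Set.singleton_union, Set.singleton_union, Fintype.card_fin] at h2

/-- A Lorentz transformation with a null eigenvector of eigenvalue other than `1` also has one of
the inverse eigenvalue, and a suitable combination of the two is a timelike eigenvector of
`f + f⁻¹`. -/
theorem IsLorentz.exists_timelike_of_null_eigenvector (hf : IsLorentz f)
    {u : Fin (d + 1) → ℝ} (hu0 : u ≠ 0) (hu : lorentz u u = 0) {a : ℝ} (hfu : f u = a • u)
    (ha1 : a ≠ 1) : ∃ v, lorentz v v < 0 ∧ ∃ c : ℝ, f (f v) = c • f v - v := by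
  have hul := last_ne_zero_of_lorentz_nonpos hu.le hu0
  have ha0 : a ≠ 0 := by
    rintro rfl
    rw [zero_smul] at hfu
    exact hu0 ((hf.injective.eq_iff' (map_zero f)).1 hfu)
  have hapos : 0 < a := by
    have key : ∀ w : Fin (d + 1) → ℝ, lorentz w w = 0 → 0 < w (Fin.last d) → f w = a • w →
        0 < a := fun w hw hl hfw => by
      have := hf.last_pos hw.le hl
      rw [hfw] at this
      exact pos_of_mul_pos_left this hl.le
    rcases lt_or_gt_of_ne hul with h | h
    · exact key (-u) (by simpa [lorentz_neg_left, lorentz_neg_right] using hu) (by simpa using h)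
        (by rw [map_neg, hfu, smul_neg])
    · exact key u hu h hfu
  have haa : a * a ≠ 1 := fun h => ha1 (by nlinarith)
  have hns : ¬Function.Surjective (a • f - 1 : Module.End ℝ (Fin (d + 1) → ℝ)) := fun hs => by
    obtain ⟨x, hx⟩ := hs (basePt d)
    have e : lorentz (basePt d) u = 0 := by
      have h1 : a * lorentz (f x) u = lorentz x u := by
        rw [← lorentz_smul_right, ← hfu, hf.map_lorentz]
      rw [← hx]
      simp only [LinearMap.sub_apply, LinearMap.smul_apply, Module.End.one_apply, lorentz_sub_left,
        lorentz_smul_left, h1, sub_self]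
    rw [lorentz_comm, lorentz_basePt] at e
    exact hul (by linarith)
  rw [← LinearMap.injective_iff_surjective, injective_iff_map_eq_zero] at hns
  push Not at hns
  obtain ⟨w, hw, hw0⟩ := hns
  have hfw : a • f w = w := by
    simpa [sub_eq_zero] using hw
  have hww : lorentz w w = 0 := by
    have h1 : lorentz w w = a * a * lorentz w w := by
      conv_lhs => rw [← hfw]
      rw [lorentz_smul_left, lorentz_smul_right, hf.map_lorentz, mul_assoc]
    have h2 : (a * a - 1) * lorentz w w = 0 := by linarith
    exact (mul_eq_zero.1 h2).resolve_left (sub_ne_zero.2 haa)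
  have hwu : lorentz w u ≠ 0 := fun h0 => by
    obtain ⟨b, rfl⟩ := eq_smul_of_null hu hu0 h0 hww.le
    rw [map_smul, hfu, ← sub_eq_zero] at hfw
    have hb : b ≠ 0 := by
      rintro rfl
      simp at hw0
    have h3 : b • ((a * a - 1) • u) = 0 := by
      rw [← hfw]; module
    exact (smul_eq_zero.1 ((smul_eq_zero.1 h3).resolve_left hb)).elim (sub_ne_zero.2 haa) hu0
  have hfw' : f w = a⁻¹ • w := by
    conv_rhs => rw [← hfw]
    rw [smul_smul, inv_mul_cancel₀ ha0, one_smul]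
  refine ⟨u - lorentz w u • w, ?_, a + a⁻¹, ?_⟩
  · simp only [lorentz_sub_left, lorentz_sub_right, lorentz_smul_left, lorentz_smul_right, hu, hww,
      lorentz_comm u w]
    have : 0 < lorentz w u ^ 2 := by positivity
    nlinarith
  · simp only [map_sub, map_smul, hfu, hfw', smul_sub, smul_smul]
    have e1 : a⁻¹ * a = 1 := inv_mul_cancel₀ ha0
    have e2 : a * a⁻¹ = 1 := mul_inv_cancel₀ ha0
    match_scalars <;> field_simp <;> ring

/-- Every orthochronous Lorentz transformation of `ℝ^(d+1)` is conjugate to its inverse by one of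
determinant `(-1) ^ ((d + 1) / 2)`. -/
theorem IsLorentz.exists_reverser (hf : IsLorentz f) :
    ∃ h, IsLorentz h ∧ LinearMap.det h = (-1) ^ ((d + 1) / 2) ∧ f * h * f = h := by
  have key : ∃ h, IsReverser f ⊤ h ∧ LinearMap.det h = (-1) ^ ((d + 1) / 2) := by
    rcases hf.exists_timelike_or_null with ⟨v, hv, c, hfv⟩ | ⟨u, hu0, hu, a, hfu⟩
    · exact hf.exists_reverser_of_timelike hv hfv
    · by_cases ha : a = 1
      · rw [ha, one_smul] at hfu
        exact hf.exists_reverser_of_fixed_null hu0 hu hfu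
      · obtain ⟨v, hv, c, hfv⟩ := hf.exists_timelike_of_null_eigenvector hu0 hu hfu ha
        exact hf.exists_reverser_of_timelike hv hfv
  obtain ⟨h, hr, hdet⟩ := key
  exact ⟨h, hr.isLorentz, hdet, LinearMap.ext fun x => hr.rev x Submodule.mem_top⟩

end Reverser

/-! ### Generic elements that are not real -/

section PairBlocks

variable {d : ℕ}

/-- The even index `2k` of the `k`-th coordinate pair. -/
def fstIdx (k : Fin ((d + 1) / 2)) : Fin (d + 1) := ⟨2 * k.val, by omega⟩

/-- The odd index `2k + 1` of the `k`-th coordinate pair. -/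
def sndIdx (k : Fin ((d + 1) / 2)) : Fin (d + 1) := ⟨2 * k.val + 1, by omega⟩

/-- The determinant of a matrix that is block diagonal for the coordinate pairs `{2k, 2k + 1}`.
If `d` is even, the last coordinate is a block of its own. -/
theorem det_eq_prod_pairs (M : Matrix (Fin (d + 1)) (Fin (d + 1)) ℝ)
    (hM : ∀ a b : Fin (d + 1), a.val / 2 ≠ b.val / 2 → M a b = 0) :
    M.det = (∏ k : Fin ((d + 1) / 2), (M (fstIdx k) (fstIdx k) * M (sndIdx k) (sndIdx k) -
      M (fstIdx k) (sndIdx k) * M (sndIdx k) (fstIdx k))) *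
      if Even d then M (Fin.last d) (Fin.last d) else 1 := by
  have hbt : M.BlockTriangular fun a : Fin (d + 1) => a.val / 2 := fun a b hab => hM a b hab.ne'
  rw [hbt.det]
  have himg : Finset.univ.image (fun a : Fin (d + 1) => a.val / 2) =
      Finset.range ((d + 2) / 2) := by
    ext k
    simp only [Finset.mem_image, Finset.mem_univ, true_and, Finset.mem_range]
    constructor
    · rintro ⟨a, rfl⟩
      omega
    · intro hk
      exact ⟨⟨2 * k, by omega⟩, by simp⟩
  have hpair : ∀ k : Fin ((d + 1) / 2),
      (M.toSquareBlock (fun a : Fin (d + 1) => a.val / 2) k.val).det =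
        M (fstIdx k) (fstIdx k) * M (sndIdx k) (sndIdx k) -
          M (fstIdx k) (sndIdx k) * M (sndIdx k) (fstIdx k) := by
    intro k
    have hf : (fstIdx k).val / 2 = k.val := by simp [fstIdx]
    have hs : (sndIdx k).val / 2 = k.val := by simp [sndIdx]; omega
    let e : Fin 2 ≃ {a : Fin (d + 1) // a.val / 2 = k.val} :=
      Equiv.ofBijective ![⟨fstIdx k, hf⟩, ⟨sndIdx k, hs⟩] <| by
        constructor
        · intro a b hab
          fin_cases a <;> fin_cases b <;> simp_all [fstIdx, sndIdx]
        · rintro ⟨a, ha⟩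
          rcases Nat.mod_two_eq_zero_or_one a.val with h | h
          · exact ⟨0, Subtype.ext (Fin.ext (by simp [fstIdx]; omega))⟩
          · exact ⟨1, Subtype.ext (Fin.ext (by simp [sndIdx]; omega))⟩
    rw [← Matrix.det_submatrix_equiv_self e, Matrix.det_fin_two]
    rfl
  rw [himg]
  by_cases hd : Even d
  · obtain ⟨r, hr⟩ := hd
    have h1 : (d + 2) / 2 = (d + 1) / 2 + 1 := by omega
    rw [h1, Finset.prod_range_succ, Finset.prod_range, if_pos ⟨r, hr⟩,
      Finset.prod_congr rfl fun k _ => hpair k]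
    congr 1
    have hl : (Fin.last d).val / 2 = (d + 1) / 2 := by
      rw [Fin.val_last]; omega
    let u : Unique {a : Fin (d + 1) // a.val / 2 = (d + 1) / 2} :=
      ⟨⟨⟨Fin.last d, hl⟩⟩, fun a => Subtype.ext (Fin.ext (by
        have := a.2
        have := a.1.2
        change a.1.val = d
        omega))⟩
    rw [Matrix.det_unique]
    rfl
  · have h1 : (d + 2) / 2 = (d + 1) / 2 := by
      rw [Nat.not_even_iff_odd] at hd
      obtain ⟨r, hr⟩ := hd
      omega
    rw [h1, Finset.prod_range, if_neg hd, mul_one, Finset.prod_congr rfl fun k _ => hpair k]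

end PairBlocks

section PairMaps

variable {d : ℕ}

theorem lorentz_eq_sum (x y : Fin (d + 1) → ℝ) :
    lorentz x y = ∑ a, (if a = Fin.last d then -1 else 1) * (x a * y a) := by
  rw [Fin.sum_univ_castSucc, lorentz]
  simp [(Fin.castSucc_lt_last _).ne, sub_eq_add_neg]

/-- The linear map that acts on the coordinates `a` and `p a` by a `2 × 2` matrix with diagonal
entries `c a` and off-diagonal entries `q a`. -/
def pairMap (p : Fin (d + 1) → Fin (d + 1)) (c q : Fin (d + 1) → ℝ) :
    Module.End ℝ (Fin (d + 1) → ℝ) where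
  toFun x a := c a * x a + q a * x (p a)
  map_add' x y := by funext a; simp only [Pi.add_apply]; ring
  map_smul' r x := by
    funext a; simp only [Pi.smul_apply, smul_eq_mul, RingHom.id_apply]; ring

theorem pairMap_apply (p : Fin (d + 1) → Fin (d + 1)) (c q x : Fin (d + 1) → ℝ)
    (a : Fin (d + 1)) : pairMap p c q x a = c a * x a + q a * x (p a) := rfl

/-- The coefficients of a product of commuting plane rotations and boosts in the coordinate planes
`{a, p a}`. -/
structure IsPairing (p : Fin (d + 1) → Fin (d + 1)) (c q : Fin (d + 1) → ℝ) : Prop where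
  invol : ∀ a, p (p a) = a
  cos_eq : ∀ a, c (p a) = c a
  norm_eq : ∀ a, c a * c a - q a * q (p a) = 1
  skew : ∀ a, (if p a = Fin.last d then -1 else 1) * q (p a) =
    -((if a = Fin.last d then -1 else 1) * q a)

variable {p : Fin (d + 1) → Fin (d + 1)} {c q : Fin (d + 1) → ℝ}

theorem IsPairing.neg (h : IsPairing p c q) : IsPairing p c (-q) where
  invol := h.invol
  cos_eq := h.cos_eq
  norm_eq a := by simpa using h.norm_eq a
  skew a := by
    have := h.skew a
    simp only [Pi.neg_apply, mul_neg]
    rw [this]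

theorem IsPairing.mul_neg (h : IsPairing p c q) : pairMap p c q * pairMap p c (-q) = 1 := by
  refine LinearMap.ext fun x => funext fun a => ?_
  simp only [Module.End.mul_apply, pairMap_apply, Pi.neg_apply, h.invol, h.cos_eq,
    Module.End.one_apply]
  linear_combination x a * h.norm_eq a

theorem IsPairing.neg_mul (h : IsPairing p c q) : pairMap p c (-q) * pairMap p c q = 1 := by
  simpa using h.neg.mul_neg

theorem IsPairing.lorentz_map (h : IsPairing p c q) (x y : Fin (d + 1) → ℝ) :
    lorentz (pairMap p c q x) (pairMap p c q y) = lorentz x y := by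
  have key : ∀ x y, lorentz (pairMap p c q x) y = lorentz x (pairMap p c (-q) y) := fun x y => by
    simp only [lorentz_eq_sum, pairMap_apply, Pi.neg_apply, mul_add, add_mul,
      Finset.sum_add_distrib]
    congr 1
    · exact Finset.sum_congr rfl fun a _ => by ring
    · refine (Equiv.sum_comp (Function.Involutive.toPerm p h.invol) _).symm.trans
        (Finset.sum_congr rfl fun a _ => ?_)
      change (if p a = Fin.last d then -1 else 1) * (q (p a) * x (p (p a)) * y (p a)) = _
      rw [h.invol]
      linear_combination x a * y (p a) * h.skew a
  rw [key, ← Module.End.mul_apply, h.neg_mul, Module.End.one_apply]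

/-- The coordinate relations satisfied by a linear map that conjugates `pairMap p c q` to its
inverse. -/
theorem IsPairing.apply_single_eq (h : IsPairing p c q) {g : Module.End ℝ (Fin (d + 1) → ℝ)}
    (hg : pairMap p c q * g * pairMap p c q = g) (a b : Fin (d + 1)) :
    (c a - c b) * g (Pi.single b 1) a = 0 ∧
      q (p b) * g (Pi.single (p b) 1) a = -(q a * g (Pi.single b 1) (p a)) := by
  have h1 : g * pairMap p c q = pairMap p c (-q) * g := by
    conv_rhs => rw [← hg]
    rw [← mul_assoc, ← mul_assoc, h.neg_mul, one_mul]
  have h2 : pairMap p c q * g = g * pairMap p c (-q) := by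
    conv_rhs => rw [← hg]
    rw [mul_assoc, h.mul_neg, mul_one]
  have hs (q' : Fin (d + 1) → ℝ) : pairMap p c q' (Pi.single b 1) =
      c b • Pi.single b 1 + q' (p b) • Pi.single (p b) 1 := by
    funext a
    simp only [pairMap_apply, Pi.add_apply, Pi.smul_apply, smul_eq_mul, Pi.single_apply]
    have e : p a = b ↔ a = p b := ⟨fun e => by rw [← e, h.invol], fun e => by rw [e, h.invol]⟩
    simp only [e]
    congr 1
    · split_ifs with hab
      · rw [hab]
      · simp
    · split_ifs with hab
      · rw [hab]
      · simp
  have e1 := congrFun (LinearMap.congr_fun h1 (Pi.single b 1)) a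
  have e2 := congrFun (LinearMap.congr_fun h2 (Pi.single b 1)) a
  simp only [Module.End.mul_apply, hs, map_add, map_smul, pairMap_apply, Pi.add_apply,
    Pi.smul_apply, smul_eq_mul, Pi.neg_apply] at e1 e2
  have h3 : (c a - c b) * g (Pi.single b 1) a = 0 := by linarith
  exact ⟨h3, by linarith⟩

end PairMaps

section Generic

variable {d : ℕ}

/-- The involution that swaps the coordinates `2k` and `2k + 1`; if `d` is even, it fixes the last
coordinate. -/
def pairIdx (a : Fin (d + 1)) : Fin (d + 1) :=
  ⟨if a.val % 2 = 0 then (if a.val = d then a.val else a.val + 1) else a.val - 1, by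
    have := a.2
    split_ifs <;> omega⟩

/-- The diagonal entries of a generic element: a different cosine in each of the coordinate pairs,
and in the last block `cosh = 2` if this is a pair and `1` if it is a single coordinate. -/
noncomputable def genCos (a : Fin (d + 1)) : ℝ :=
  if a.val / 2 = d / 2 then (if Even d then 1 else 2) else ((a.val / 2 : ℕ) + 2 : ℝ)⁻¹

/-- The off-diagonal entries that go with `genCos`. -/
noncomputable def genSin (a : Fin (d + 1)) : ℝ :=
  if a.val / 2 = d / 2 then (if Even d then 0 else √3)
  else (if a.val % 2 = 0 then -1 else 1) * √(1 - ((a.val / 2 : ℕ) + 2 : ℝ)⁻¹ ^ 2)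

theorem pairIdx_div_two (a : Fin (d + 1)) : (pairIdx a).val / 2 = a.val / 2 := by
  simp only [pairIdx]
  split_ifs <;> omega

theorem pairIdx_pairIdx (a : Fin (d + 1)) : pairIdx (pairIdx a) = a := by
  have := a.2
  refine Fin.ext ?_
  simp only [pairIdx]
  split_ifs <;> omega

theorem inv_add_two_lt_one (k : ℕ) : ((k : ℝ) + 2)⁻¹ < 1 :=
  inv_lt_one_of_one_lt₀ (by have : (0 : ℝ) ≤ k := k.cast_nonneg; linarith)

theorem inv_add_two_pos (k : ℕ) : 0 < ((k : ℝ) + 2)⁻¹ := by positivity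

theorem genCos_eq_iff (a b : Fin (d + 1)) : genCos a = genCos b ↔ a.val / 2 = b.val / 2 := by
  refine ⟨fun h => ?_, fun h => by simp only [genCos, h]⟩
  have ha := inv_add_two_lt_one (a.val / 2)
  have hb := inv_add_two_lt_one (b.val / 2)
  simp only [genCos] at h
  split_ifs at h with h1 h2 h3 h4 h5 <;> try omega
  all_goals try linarith
  rw [inv_inj, add_left_inj] at h
  exact_mod_cast h

theorem isPairing_gen : IsPairing (d := d) pairIdx genCos genSin where
  invol := pairIdx_pairIdx
  cos_eq a := (genCos_eq_iff _ _).2 (pairIdx_div_two a)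
  norm_eq a := by
    have h3 : √3 * √3 = 3 := Real.mul_self_sqrt (by norm_num)
    have hk := inv_add_two_lt_one (a.val / 2)
    have hk' := inv_add_two_pos (a.val / 2)
    have hs := Real.mul_self_sqrt (show 0 ≤ 1 - ((a.val / 2 : ℕ) + 2 : ℝ)⁻¹ ^ 2 by nlinarith)
    have hpar : a.val / 2 ≠ d / 2 → ((pairIdx a).val % 2 = 0 ↔ ¬a.val % 2 = 0) := fun h => by
      simp only [pairIdx]
      have := a.2
      split_ifs <;> omega
    simp only [genCos, genSin, pairIdx_div_two]
    by_cases hl : a.val / 2 = d / 2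
    · simp only [hl, if_true]
      split_ifs
      · norm_num
      · linarith
    · simp only [hl, if_false, hpar hl]
      split_ifs <;> nlinarith
  skew a := by
    have ha := a.2
    have hlast (b : Fin (d + 1)) : b = Fin.last d ↔ b.val = d := by
      rw [Fin.ext_iff, Fin.val_last]
    by_cases hl : a.val / 2 = d / 2
    · simp only [genSin, pairIdx_div_two, hl, if_true]
      by_cases hd : Even d
      · simp [hd]
      · have hd' := hd
        rw [Nat.not_even_iff_odd] at hd'
        obtain ⟨r, hr⟩ := hd'
        have hpar : (pairIdx a).val = d ↔ ¬a.val = d := by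
          simp only [pairIdx]
          split_ifs <;> omega
        simp only [hd, if_false, hlast, hpar]
        split_ifs <;> ring
    · have hpar : (pairIdx a).val % 2 = 0 ↔ ¬a.val % 2 = 0 := by
        simp only [pairIdx]
        split_ifs <;> omega
      have h1 : ¬(pairIdx a).val = d := fun h => hl (by rw [← pairIdx_div_two, h])
      have h2 : ¬a.val = d := fun h => hl (by rw [h])
      simp only [genSin, pairIdx_div_two, hl, if_false, hlast, h1, h2, hpar]
      split_ifs <;> ring

theorem pairIdx_fstIdx (k : Fin ((d + 1) / 2)) : pairIdx (fstIdx k) = sndIdx k := by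
  have := k.2
  have h : 2 * k.val ≠ d := by omega
  exact Fin.ext (by simp [pairIdx, fstIdx, sndIdx, h])

theorem pairIdx_sndIdx (k : Fin ((d + 1) / 2)) : pairIdx (sndIdx k) = fstIdx k := by
  rw [← pairIdx_fstIdx, pairIdx_pairIdx]

theorem fstIdx_ne_sndIdx (k : Fin ((d + 1) / 2)) : fstIdx k ≠ sndIdx k := fun h => by
  have := congrArg Fin.val h
  simp [fstIdx, sndIdx] at this

theorem pairMap_gen_basePt_last :
    pairMap pairIdx genCos genSin (basePt d) (Fin.last d) = genCos (Fin.last d) := by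
  rw [pairMap_apply, basePt_last, mul_one, add_eq_left]
  by_cases hd : Even d
  · simp [genSin, hd]
  · rw [Nat.not_even_iff_odd] at hd
    obtain ⟨r, hr⟩ := hd
    have h : pairIdx (Fin.last d) ≠ Fin.last d := fun h => by
      have := congrArg Fin.val h
      simp only [pairIdx, Fin.val_last] at this
      split_ifs at this <;> omega
    rw [basePt, Pi.single_eq_of_ne h, mul_zero]

theorem isLorentz_pairMap_gen : IsLorentz (pairMap (d := d) pairIdx genCos genSin) where
  map_lorentz := isPairing_gen.lorentz_map
  basePt_pos := by
    rw [pairMap_gen_basePt_last]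
    simp only [genCos, Fin.val_last, if_true]
    split_ifs <;> norm_num

theorem det_pairMap_gen : LinearMap.det (pairMap (d := d) pairIdx genCos genSin) = 1 := by
  have hent : ∀ a b : Fin (d + 1), LinearMap.toMatrix' (pairMap pairIdx genCos genSin) a b =
      genCos a * (if a = b then 1 else 0) + genSin a * (if pairIdx a = b then 1 else 0) :=
    fun a b => by
      rw [LinearMap.toMatrix'_apply, pairMap_apply, Pi.single_apply, Pi.single_apply]
  rw [← LinearMap.det_toMatrix', det_eq_prod_pairs]
  · rw [Finset.prod_eq_one, one_mul]
    · by_cases hd : Even d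
      · rw [if_pos hd, LinearMap.toMatrix'_apply]
        exact pairMap_gen_basePt_last.trans (by simp [genCos, hd])
      · rw [if_neg hd]
    · intro k _
      have h2 : genCos (sndIdx k) = genCos (fstIdx k) := by
        rw [← pairIdx_fstIdx, isPairing_gen.cos_eq]
      have h3 := isPairing_gen.norm_eq (fstIdx k)
      rw [pairIdx_fstIdx] at h3
      simp only [hent, pairIdx_fstIdx, pairIdx_sndIdx, fstIdx_ne_sndIdx, (fstIdx_ne_sndIdx k).symm,
        if_true, if_false, h2]
      linarith
  · intro a b hab
    have h1 : a ≠ b := fun h => hab (by rw [h])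
    have h2 : pairIdx a ≠ b := fun h => hab (by rw [← h, pairIdx_div_two])
    simp [hent, h1, h2]

/-- A Lorentz transformation that conjugates the generic element to its inverse preserves each
coordinate pair, because the cosines are different, and acts on it with nonpositive determinant.
This determines the sign of its determinant. -/
theorem det_reverser_gen {g : Module.End ℝ (Fin (d + 1) → ℝ)} (hg : IsLorentz g)
    (hrev : pairMap pairIdx genCos genSin * g * pairMap pairIdx genCos genSin = g) :
    0 ≤ (-1) ^ ((d + 1) / 2) * LinearMap.det g := by
  have hrel := isPairing_gen.apply_single_eq hrev
  rw [← LinearMap.det_toMatrix', det_eq_prod_pairs, ← mul_assoc]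
  swap
  · intro a b hab
    rw [LinearMap.toMatrix'_apply]
    exact (mul_eq_zero.1 (hrel a b).1).resolve_left
      (sub_ne_zero.2 fun h => hab ((genCos_eq_iff a b).1 h))
  simp only [LinearMap.toMatrix'_apply]
  refine mul_nonneg ?_ ?_
  · have hc : (-1 : ℝ) ^ ((d + 1) / 2) = ∏ _k : Fin ((d + 1) / 2), (-1 : ℝ) := by simp
    rw [hc, ← Finset.prod_mul_distrib]
    refine Finset.prod_nonneg fun k _ => ?_
    have e1 := (hrel (fstIdx k) (fstIdx k)).2
    have e2 := (hrel (fstIdx k) (sndIdx k)).2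
    rw [pairIdx_fstIdx] at e1
    rw [pairIdx_sndIdx, pairIdx_fstIdx] at e2
    set i := fstIdx k with hi
    set j := sndIdx k with hj
    by_cases hl : k.val = d / 2
    · -- the boost block: the column of `j`, the last index, is timelike
      have hdj : j = Fin.last d := Fin.ext (by
        have := k.2
        simp only [hj, sndIdx, Fin.val_last]
        omega)
      have hodd : ¬Even d := fun ⟨r, hr⟩ => by
        have := k.2
        omega
      have hqi : genSin i = √3 := by
        have : i.val / 2 = d / 2 := by simp [hi, fstIdx, hl]
        simp [genSin, this, hodd]
      have hqj : genSin j = √3 := by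
        simp [genSin, hdj, hodd]
      have hs3 : √3 ≠ 0 := by positivity
      simp only [hqi, hqj, ← mul_neg, mul_right_inj' hs3] at e1 e2
      have hnorm := hg.map_lorentz (Pi.single j 1) (Pi.single j 1)
      rw [hdj, show lorentz (Pi.single (Fin.last d) (1 : ℝ)) (Pi.single (Fin.last d) 1) = -1 from
        by simp [lorentz], ← hdj, lorentz] at hnorm
      have hile : i = (⟨i.val, by simp only [hi, fstIdx]; omega⟩ : Fin d).castSucc := rfl
      have hle := Finset.single_le_sum (f := fun a : Fin d =>
        g (Pi.single j 1) a.castSucc * g (Pi.single j 1) a.castSucc)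
        (fun a _ => mul_self_nonneg _) (Finset.mem_univ ⟨i.val, by simp only [hi, fstIdx]; omega⟩)
      rw [← hile] at hle
      rw [← hdj] at hnorm
      have e3 : g (Pi.single i 1) i = -g (Pi.single j 1) j := by linarith
      have e4 : g (Pi.single i 1) j = -g (Pi.single j 1) i := by linarith
      rw [e3, e4]
      nlinarith
    · -- a rotation block: the restriction is a multiple of a reflection
      have hki : i.val / 2 = k.val := by simp [hi, fstIdx]
      have hkj : j.val / 2 = k.val := by simp only [hj, sndIdx]; omega
      have hmi : i.val % 2 = 0 := by simp [hi, fstIdx]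
      have hmj : ¬j.val % 2 = 0 := by simp only [hj, sndIdx]; omega
      have hk := inv_add_two_lt_one k.val
      have hk' := inv_add_two_pos k.val
      have hs : √(1 - ((k.val : ℝ) + 2)⁻¹ ^ 2) ≠ 0 := (Real.sqrt_pos.2 (by nlinarith)).ne'
      simp only [genSin, hki, hkj, hl, hmi, hmj, if_true, if_false, neg_mul, one_mul, neg_neg]
        at e1 e2
      rw [mul_right_inj' hs] at e1
      rw [← mul_neg, mul_right_inj' hs] at e2
      rw [e1, ← e2]
      nlinarith [mul_self_nonneg (g (Pi.single i 1) i), mul_self_nonneg (g (Pi.single i 1) j)]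
  · split_ifs
    · exact hg.basePt_pos.le
    · exact zero_le_one

end Generic

/-! ### Reality in the identity component -/

section Reality

theorem IsRealElement.map {G H : Type*} [Group G] [Group H] (e : G →* H) {g : G}
    (hg : IsRealElement g) : IsRealElement (e g) := by
  obtain ⟨h, hh⟩ := hg
  exact ⟨e h, by rw [← map_inv, ← map_mul, ← map_mul, hh, map_inv]⟩

theorem forall_isRealElement_congr {G H : Type*} [Group G] [Group H] (e : G ≃* H) :
    (∀ g : G, IsRealElement g) ↔ ∀ h : H, IsRealElement h :=
  ⟨fun hG h => by simpa using (hG (e.symm h)).map (e : G →* H),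
    fun hH g => by simpa using (hH (e g)).map (e.symm : H →* G)⟩

/-- All elements of `SO_o(d, 1)` are real if and only if the reversers produced by
`IsLorentz.exists_reverser` have determinant `1`. -/
theorem forall_isRealElement_SOo_iff {d : ℕ} (hd : 2 ≤ d) :
    (∀ A : SOo d, IsRealElement A) ↔ Even ((d + 1) / 2) := by
  constructor
  · intro hreal
    by_contra hodd
    rw [Nat.not_even_iff_odd] at hodd
    have hL : IsLorentz (pairMap (d := d) pairIdx genCos genSin) := isLorentz_pairMap_gen
    let T : SO d := ofEnd _ det_pairMap_gen hL.map_lorentz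
    have hTe : toEnd d T = pairMap pairIdx genCos genSin := toEnd_ofEnd _ _ _
    have hT : T ∈ SOo d := (mem_SOo_iff hd).2 (by rw [hTe]; exact hL)
    obtain ⟨B, hB⟩ := hreal ⟨T, hT⟩
    have hB' : T * B.1 * T = B.1 := by
      have h1 : B.1 * T * B.1⁻¹ = T⁻¹ := congrArg Subtype.val hB
      rw [mul_assoc, mul_inv_eq_iff_eq_mul.1 h1, mul_inv_cancel_left]
    have h2 := det_reverser_gen (isLorentz_of_mem_SOo B.2) (by
      rw [← hTe, ← map_mul, ← map_mul, hB'])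
    rw [det_toEnd, hodd.neg_one_pow] at h2
    norm_num at h2
  · intro heven A
    obtain ⟨h, hh, hdet, hrev⟩ := (isLorentz_of_mem_SOo A.2).exists_reverser
    rw [heven.neg_one_pow] at hdet
    let B : SO d := ofEnd h hdet hh.map_lorentz
    have hBe : toEnd d B = h := toEnd_ofEnd _ _ _
    have hB : B ∈ SOo d := (mem_SOo_iff hd).2 (by rw [hBe]; exact hh)
    refine ⟨⟨B, hB⟩, Subtype.ext ?_⟩
    change B * A.1 * B⁻¹ = (A.1)⁻¹
    have h1 : A.1 * B * A.1 = B := toEnd_injective (by rw [map_mul, map_mul, hBe, hrev])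
    rw [mul_inv_eq_iff_eq_mul, eq_inv_mul_iff_mul_eq, ← mul_assoc, h1]

end Reality

end MoebiusReal

theorem corollary1p2 (n : ℕ) (hn : 1 ≤ n) :
    (∃ e : MoebiusReal.SOo (n + 1) ≃* MoebiusReal.MoebiusO n,
      ∀ (A : MoebiusReal.SOo (n + 1)) (x : MoebiusReal.Hyp (n + 1)),
        ((e A : MoebiusReal.Moebius n) x).val =
          ((A : MoebiusReal.SO (n + 1)) : GL (Fin (n + 1 + 1)) ℝ).val.mulVec x.val) ∧
    ((∀ T : MoebiusReal.MoebiusO n, MoebiusReal.IsRealElement T) ↔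
      n ≡ 2 [MOD 4] ∨ n ≡ 3 [MOD 4]) := by
  refine ⟨⟨MoebiusReal.equivMoebiusO n, MoebiusReal.equivMoebiusO_apply⟩, ?_⟩
  rw [← MoebiusReal.forall_isRealElement_congr (MoebiusReal.equivMoebiusO n),
    MoebiusReal.forall_isRealElement_SOo_iff (by omega), Nat.even_iff]
  simp only [Nat.ModEq]
  omega
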